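/- Let $\pi : X\to Y$ be a morphism of schemes that is locally of finite presentation, let $x\in X$ and $y=\pi(x)$, let $k_{Y,y}$ be the residue field of $Y$ at $y$, and let $X_y=X\times_Y \operatorname{Spec} k_{Y,y}$ be the fibre, in which $x$ is regarded as a point. Conventions. A morphism $f: X\to Y$ is flat at $x$ if $\mathcal O_{Y,f(x)}\to\mathcal O_{X,x}$ is flat, and it is smooth at $x$ if it is locally of finite presentation and $\mathcal O_{Y,f(x)}\to\mathcal O_{X,x}$ is formally smooth. $\Omega_{X/Y}$ is the sheaf of Kähler differentials, with stalks $\Omega_{X/Y,x}=\Omega_{\mathcal O_{X,x}/\mathcal O_{Y,\pi(x)}}$, and $B_\pi=\{x\in X \mid \Omega_{X/Y,x}\text{ is not a free }\mathcal O_{X,x}\text{-module}\}$ is the branch locus. $\operatorname{Max}(X)$ is the set of points of $X$ that have no proper generalisation (the points of height $0$). A point $\xi$ specialises to $x$ if $x\in\overline{\{\xi\}}$. For a topological space $T$ and $x\in T$, $\dim_x T=\inf_U \dim U$, where $U$ runs over the open neighbourhoods of $x$ and $\dim U$ is the Krull dimension of $U$. The following are equivalent: 1. $\pi$ is smooth at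 $x$. 2. $\pi$ is flat at $x$, $x\notin B_\pi$, and $\pi$ is smooth at every point $\xi\in\operatorname{Max}(X)$ that specialises to $x$. 3. $\pi$ is flat at $x$, $x\notin B_\pi$, and $\operatorname{rk}\Omega_{X/Y,x}=\dim_x X_y$. 4. $\pi$ is flat at $x$, $x\notin B_\pi$, and $X_y\to\operatorname{Spec} k_{Y,y}$ is smooth at every point $\eta\in\operatorname{Max}(X_y)$ that specialises to $x$. -/

import Mathlib

open CategoryTheory AlgebraicGeometry

universe u

noncomputable section

/-- The local dimension `dim_x T` of a topological space at a point: the infimum of the Krull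
dimensions of the open neighbourhoods of `x`. -/
def dimensionAt {T : Type u} [TopologicalSpace T] (x : T) : WithBot ℕ∞ :=
  ⨅ (U : TopologicalSpace.Opens T) (_ : x ∈ U), topologicalKrullDim U

namespace AlgebraicGeometry

/-- The set `Max(X)` of maximal points of `X`: the points without a proper generalisation, i.e.
the points of height `0`, i.e. the generic points of the irreducible components. -/
def Scheme.maximalPoints (X : Scheme.{u}) : Set X :=
  {ξ | ∀ ξ' : X, ξ' ⤳ ξ → ξ' = ξ}

/-- `f` is flat at `x`: the local homomorphism `𝒪_{Y, f(x)} → 𝒪_{X, x}` is flat. -/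
def Scheme.Hom.IsFlatAt {X Y : Scheme.{u}} (f : X ⟶ Y) (x : X) : Prop :=
  (f.stalkMap x).hom.Flat

/-- `f` is smooth at `x`: it is locally of finite presentation and the local homomorphism
`𝒪_{Y, f(x)} → 𝒪_{X, x}` is formally smooth. -/
def Scheme.Hom.IsSmoothAt {X Y : Scheme.{u}} (f : X ⟶ Y) (x : X) : Prop :=
  LocallyOfFinitePresentation f ∧ (f.stalkMap x).hom.FormallySmooth

/-- The stalk `Ω_{X/Y, x}` of the sheaf of Kähler differentials, as an `𝒪_{X, x}`-module: it is
the module of Kähler differentials of `𝒪_{X, x}` over `𝒪_{Y, f(x)}`. -/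
abbrev Scheme.Hom.differentialsStalk {X Y : Scheme.{u}} (f : X ⟶ Y) (x : X) :
    ModuleCat.{u} (X.presheaf.stalk x) :=
  CommRingCat.KaehlerDifferential (f.stalkMap x)

/-- The branch locus `B_f`: the points `x` where `Ω_{X/Y, x}` is not a free
`𝒪_{X, x}`-module. -/
def Scheme.Hom.branchLocus {X Y : Scheme.{u}} (f : X ⟶ Y) : Set X :=
  {x | ¬ Module.Free (X.presheaf.stalk x) (f.differentialsStalk x)}

/-- The rank of `Ω_{X/Y, x}` over `𝒪_{X, x}` (meaningful where this module is free). -/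
def Scheme.Hom.differentialsRank {X Y : Scheme.{u}} (f : X ⟶ Y) (x : X) : ℕ :=
  Module.finrank (X.presheaf.stalk x) (f.differentialsStalk x)

end AlgebraicGeometry

end

open scoped TensorProduct

/-! The question is local: take `R → S` of finite presentation, a prime `q` of `S`, the residue
field `K` of `R` below `q`, and the fibre `F = K ⊗ S` with a prime `Q` over `q`. Smoothness gives
flatness and free differentials, and passes to generisations and to the fibre. Conversely, flatness
reduces smoothness at `q` to smoothness of `F` at `Q` (`Algebra.IsSmoothAt.of_isSmoothAt_fiber`),
and it remains to compare the rank `n` of `Ω` with dimensions.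

Functions whose differentials form a basis of `Ω` give a map from a polynomial ring in `n` variables
that is unramified at `Q`, so `F` has dimension at most `n` near `Q`. Over a normal domain an
unramified point is étale once the base injects into the local ring
(`Algebra.IsUnramifiedAt.isEtaleAt_of_injective`). Hence, if `F` is not smooth at `Q`, a nonzero
polynomial vanishes near `Q` and the dimension drops below `n`
(`Algebra.exists_ringKrullDim_away_lt_of_not_isSmoothAt`). This settles the rank criterion.

For the generic points, let `S` be smooth at a minimal prime `P ≤ q`, where `Ω` again has rank `n`.
Étale coordinates at `P` are flat, so by going down they stay algebraically independent in `S/P`. If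
`F` were not smooth at `Q`, Noether normalisation would make a neighbourhood of `Q` finite over a
polynomial ring in `d < n` variables. That map lifts to one from a polynomial ring over `R`,
quasi-finite at `q` and hence at `P`, which bounds the transcendence degree of `S/P` by `d`: a
contradiction (`Algebra.IsSmoothAt.of_mem_minimalPrimes`). Here `P` need not lie in the fibre
through `q`. The same argument applied to `K → F` handles the generic points of the fibre. -/

/-- Every principal ideal of a reduced Artinian ring is generated by an idempotent multiple. -/
lemma IsArtinianRing.exists_mul_mul_eq_self {T : Type*} [CommRing T] [IsArtinianRing T]
    [IsReduced T] (a : T) : ∃ c, a * a * c = a := by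
  obtain ⟨n, y, h⟩ := IsArtinian.exists_pow_succ_smul_dvd (R := T) (M := T) a 1
  refine ⟨y, ?_⟩
  have h0 : a ^ n * (1 - a * y) = 0 := by
    simp only [smul_eq_mul, mul_one, Nat.succ_eq_add_one, pow_succ] at h
    linear_combination -h
  -- Stabilisation of the powers of `a` only makes `a * (1 - a * y)` nilpotent; reducedness then
  -- makes it zero.
  have h1 : (a * (1 - a * y)) ^ (n + 1) = 0 := by
    rw [mul_pow, pow_succ a, pow_succ (1 - a * y)]
    linear_combination (a * (1 - a * y) ^ n) * h0
  have h2 := pow_eq_zero_iff (n.succ_ne_zero) |>.mp h1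
  linear_combination -h2

/-! ### Unramified and étale points over a normal domain. -/

section NormalBase

variable {A E : Type*} [CommRing A] [IsDomain A] [IsIntegrallyClosed A] [CommRing E] [Algebra A E]

/-- A smooth algebra over a normal domain is integrally closed in its generic fibre. -/
lemma Algebra.Smooth.exists_algebraMap_eq_of_isIntegral {A E : Type*} [CommRing A]
    [IsIntegrallyClosed A] [CommRing E] [Algebra A E] [Algebra.Smooth A E]
    (x : E ⊗[A] FractionRing A) (hx : IsIntegral E x) :
    ∃ e : E, algebraMap E (E ⊗[A] FractionRing A) e = x := by
  obtain ⟨z, hz⟩ := (TensorProduct.toIntegralClosure_bijective_of_smooth (R := A) (S := E)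
    (B := FractionRing A)).2 ⟨x, hx⟩
  have key : ∀ z : E ⊗[A] integralClosure A (FractionRing A), ∃ e : E,
      algebraMap E (E ⊗[A] FractionRing A) e =
        (TensorProduct.toIntegralClosure A E (FractionRing A) z).1 := by
    intro z
    induction z with
    | zero => exact ⟨0, by simp⟩
    | add a b ha hb =>
      obtain ⟨e, he⟩ := ha
      obtain ⟨f, hf⟩ := hb
      exact ⟨e + f, by rw [map_add, he, hf, map_add]; rfl⟩
    | tmul e b =>
      obtain ⟨b, hb⟩ := b
      have hb' := hb
      rw [IsIntegrallyClosed.integralClosure_eq_bot] at hb'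
      obtain ⟨a, rfl⟩ := hb'
      refine ⟨a • e, ?_⟩
      simp only [TensorProduct.toIntegralClosure, AlgHom.coe_codRestrict,
        Algebra.TensorProduct.map_tmul, Algebra.TensorProduct.algebraMap_apply,
        Algebra.algebraMap_self, RingHom.id_apply, AlgHom.coe_id, id_eq, Subalgebra.coe_val]
      change (a • e) ⊗ₜ[A] (1 : FractionRing A) = e ⊗ₜ (algebraMap A (FractionRing A) a)
      rw [TensorProduct.smul_tmul, Algebra.algebraMap_eq_smul_one]
  obtain ⟨e, he⟩ := key z
  exact ⟨e, by rw [he, hz]⟩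

/-- The local rings of an étale algebra over a normal domain are domains. -/
theorem Algebra.Etale.isDomain_localization_atPrime [Algebra.Etale A E] (q : Ideal E)
    [q.IsPrime] : IsDomain (Localization.AtPrime q) := by
  let K := FractionRing A
  have : Algebra.FormallyUnramified K (K ⊗[A] E) := inferInstance
  have : IsReduced (K ⊗[A] E) := Algebra.FormallyUnramified.isReduced_of_field K _
  have : Module.Finite K (K ⊗[A] E) := Algebra.FormallyUnramified.finite_of_free K _
  have : IsArtinianRing (K ⊗[A] E) := .of_finite K _
  have hinj : Function.Injective (algebraMap E (E ⊗[A] K)) :=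
    Algebra.TensorProduct.includeLeft_injective (S := A) (IsFractionRing.injective A K)
  let e := Algebra.TensorProduct.comm A K E
  have reg (a : E ⊗[A] K) : ∃ c, a * a * c = a := by
    obtain ⟨c, hc⟩ := IsArtinianRing.exists_mul_mul_eq_self (e.symm a)
    refine ⟨e c, ?_⟩
    simpa using congrArg e hc
  have : Nontrivial E := (algebraMap E (Localization.AtPrime q)).domain_nontrivial
  have key (a b : E) (hab : a * b = 0) :
      algebraMap E (Localization.AtPrime q) a = 0 ∨ algebraMap E (Localization.AtPrime q) b = 0 := by
    obtain ⟨c, hc⟩ := reg (algebraMap E _ a)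
    set ι := algebraMap E (E ⊗[A] K)
    -- `ι a * c` is the idempotent cutting out the support of `a` in the generic fibre. As a root of
    -- `X ^ 2 - X` it is integral over `E`, so it already lives in `E`.
    have hid : IsIntegral E (ι a * c) := by
      refine ⟨Polynomial.X ^ 2 - Polynomial.X, Polynomial.monic_X_pow_sub (by
        rw [Polynomial.degree_X]; norm_num), ?_⟩
      simp only [Polynomial.eval₂_sub, Polynomial.eval₂_pow, Polynomial.eval₂_X]
      linear_combination c * hc
    obtain ⟨s, hs⟩ := Algebra.Smooth.exists_algebraMap_eq_of_isIntegral _ hid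
    have h1 : s * a = a := hinj (by rw [map_mul, hs]; linear_combination hc)
    have h2 : s * b = 0 := hinj (by
      rw [map_mul, hs, map_zero]
      have : ι a * ι b = 0 := by rw [← map_mul, hab, map_zero]
      linear_combination c * this)
    -- One of `s` and `1 - s` is outside `q`; the first kills `b` and the second kills `a`.
    by_cases hq : s ∈ q
    · left
      rw [IsLocalization.map_eq_zero_iff q.primeCompl]
      refine ⟨⟨1 - s, fun h ↦ q.ne_top_iff_one.mp ‹q.IsPrime›.ne_top ?_⟩, ?_⟩
      · simpa using q.add_mem h hq
      · change (1 - s) * a = 0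
        linear_combination -h1
    · right
      rw [IsLocalization.map_eq_zero_iff q.primeCompl]
      exact ⟨⟨s, hq⟩, h2⟩
  have : NoZeroDivisors (Localization.AtPrime q) := by
    refine ⟨fun {x y} hxy ↦ ?_⟩
    obtain ⟨a, s, rfl⟩ := IsLocalization.exists_mk'_eq q.primeCompl x
    obtain ⟨b, t, rfl⟩ := IsLocalization.exists_mk'_eq q.primeCompl y
    rw [← IsLocalization.mk'_mul, IsLocalization.mk'_eq_zero_iff] at hxy
    obtain ⟨m, hm⟩ := hxy
    have := key (m * a) b (by rw [mul_assoc]; exact hm)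
    rw [map_mul] at this
    simp only [IsLocalization.mk'_eq_mul_mk'_one (M := q.primeCompl) a,
      IsLocalization.mk'_eq_mul_mk'_one (M := q.primeCompl) b]
    refine this.imp (fun h ↦ ?_) fun h ↦ by rw [h, zero_mul]
    rw [((IsLocalization.map_units _ m).mul_right_eq_zero).mp h, zero_mul]
  exact NoZeroDivisors.to_isDomain _

/-- An étale algebra over a domain is algebraic. -/
lemma Algebra.Etale.isAlgebraic {A E : Type*} [CommRing A] [IsDomain A] [CommRing E]
    [Algebra A E] [Algebra.Etale A E] (e : E) : IsAlgebraic A e := by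
  let K := FractionRing A
  have : Module.Finite K (K ⊗[A] E) := Algebra.FormallyUnramified.finite_of_free K _
  let ι : E →ₐ[A] K ⊗[A] E := Algebra.TensorProduct.includeRight
  have hι : Function.Injective ι :=
    Algebra.TensorProduct.includeRight_injective (IsFractionRing.injective A K)
  have h : IsAlgebraic K (ι e) := (Algebra.IsIntegral.isIntegral (R := K) _).isAlgebraic
  have h' : IsAlgebraic A (ι e) := (IsFractionRing.isAlgebraic_iff A K (K ⊗[A] E)).mpr h
  exact (isAlgebraic_algHom_iff ι hι).mp h'

/-- A surjection from a local ring of an étale algebra over a normal domain `A` is an isomorphism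
if `A` injects into the target. -/
lemma Algebra.Etale.injective_of_localization_atPrime [Algebra.Etale A E] (Q : Ideal E)
    [Q.IsPrime] {B : Type*} [CommRing B] [Algebra A B] (θ : Localization.AtPrime Q →ₐ[A] B)
    (hinj : Function.Injective (algebraMap A B)) : Function.Injective θ := by
  have : IsDomain (Localization.AtPrime Q) := Algebra.Etale.isDomain_localization_atPrime (A := A) Q
  rw [injective_iff_map_eq_zero]
  intro x hx
  by_contra hx0
  obtain ⟨y, t, rfl⟩ := IsLocalization.exists_mk'_eq Q.primeCompl x
  have hy0 : algebraMap E (Localization.AtPrime Q) y ≠ 0 := by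
    intro h
    exact hx0 (by rw [IsLocalization.mk'_eq_mul_mk'_one, h, zero_mul])
  have hy : algebraMap E (Localization.AtPrime Q) y ∈ RingHom.ker θ := by
    rw [← IsLocalization.mk'_spec _ y t]
    exact Ideal.mul_mem_right _ _ hx
  have halg : IsAlgebraic A (algebraMap E (Localization.AtPrime Q) y) :=
    (Algebra.Etale.isAlgebraic (A := A) y).algHom (IsScalarTower.toAlgHom A E _)
  -- In a domain, an ideal containing a nonzero element algebraic over `A` meets `A` nontrivially;
  -- the kernel of `θ` does not.
  refine Ideal.comap_ne_bot_of_algebraic_mem hy0 hy halg (eq_bot_iff.mpr fun a ha ↦ ?_)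
  have : θ (algebraMap A _ a) = 0 := ha
  rw [θ.commutes] at this
  exact hinj (by rw [this, map_zero])

/-- Localising `φ` at the preimage `Q` of `q` gives a surjection from the local ring of `E` onto
that of `S`. It is injective because the source is a domain algebraic over `A`, so the local ring of
`S` is that of an étale algebra. -/
lemma Algebra.IsEtaleAt.of_surjective {S : Type*} [CommRing S] [Algebra A S] (q : Ideal S)
    [q.IsPrime] [Algebra.Etale A E] {f : S} (hfq : f ∉ q) (φ : E →ₐ[A] Localization.Away f)
    (hφ : Function.Surjective φ)
    (hinj : Function.Injective (algebraMap A (Localization.AtPrime q))) :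
    Algebra.IsEtaleAt A q := by
  let ψ : Localization.Away f →ₐ[A] Localization.AtPrime q :=
    IsLocalization.liftAlgHom (M := .powers f) (f := IsScalarTower.toAlgHom A S _) (by
      rintro ⟨_, n, rfl⟩
      simpa using (IsLocalization.map_units (M := q.primeCompl) (Localization.AtPrime q)
        ⟨f, hfq⟩).pow n)
  let χ : E →ₐ[A] Localization.AtPrime q := ψ.comp φ
  let Q : Ideal E := (IsLocalRing.maximalIdeal (Localization.AtPrime q)).comap χ.toRingHom
  have : Q.IsPrime := Ideal.IsPrime.comap _
  have hψ (s : S) : ψ (algebraMap S _ s) = algebraMap S _ s := by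
    simp [ψ]
  let θ : Localization.AtPrime Q →ₐ[A] Localization.AtPrime q :=
    IsLocalization.liftAlgHom (M := Q.primeCompl) (f := χ) (by
      rintro ⟨y, hy⟩
      simpa [Q, Ideal.mem_primeCompl_iff] using hy)
  have hθ (y : E) : θ (algebraMap E _ y) = χ y := by simp [θ]
  have hsurj : Function.Surjective θ := by
    intro x
    obtain ⟨a, ⟨s, hs⟩, rfl⟩ := IsLocalization.exists_mk'_eq q.primeCompl x
    obtain ⟨a', ha'⟩ := hφ (algebraMap _ _ a)
    obtain ⟨s', hs'⟩ := hφ (algebraMap _ _ s)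
    have hχa : χ a' = algebraMap _ _ a := by simp [χ, ha', hψ]
    have hχs : χ s' = algebraMap _ _ s := by simp [χ, hs', hψ]
    have hsu : IsUnit (χ s') := hχs ▸ IsLocalization.map_units (M := q.primeCompl) _ ⟨s, hs⟩
    have hs'Q : s' ∈ Q.primeCompl := by simpa [Q, Ideal.mem_primeCompl_iff] using hsu
    refine ⟨IsLocalization.mk' _ a' ⟨s', hs'Q⟩, ?_⟩
    rw [IsLocalization.eq_mk'_iff_mul_eq]
    change _ * algebraMap S _ s = _
    rw [← hχs, ← hχa, ← hθ s', ← map_mul]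
    erw [IsLocalization.mk'_spec _ a' (⟨s', hs'Q⟩ : Q.primeCompl)]
    rw [hθ]
  have : Algebra.FormallyEtale E (Localization.AtPrime Q) := .of_isLocalization Q.primeCompl
  have : Algebra.FormallyEtale A (Localization.AtPrime Q) := .comp A E _
  exact Algebra.FormallyEtale.of_equiv (AlgEquiv.ofBijective θ
    ⟨Algebra.Etale.injective_of_localization_atPrime Q θ hinj, hsurj⟩)

/-- An unramified point of an algebra over a normal domain at which the base injects into the
local ring is an étale point. -/
theorem Algebra.IsUnramifiedAt.isEtaleAt_of_injective {S : Type*} [CommRing S] [Algebra A S]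
    [Algebra.FiniteType A S] (q : Ideal S) [q.IsPrime] [Algebra.IsUnramifiedAt A q]
    (hinj : Function.Injective (algebraMap A (Localization.AtPrime q))) :
    Algebra.IsEtaleAt A q := by
  obtain ⟨f, hfq, P, φ, hφ⟩ := Algebra.IsUnramifiedAt.exists_hasStandardEtaleSurjectionOn (R := A) q
  have : Algebra.Etale A P.Ring := inferInstance
  exact .of_surjective q hfq φ hφ hinj

end NormalBase

/-! ### Krull dimension under quasi-finite and integral maps. -/

section Dimension

/-- Unramified algebras essentially of finite type are quasi-finite. -/
lemma Algebra.QuasiFinite.of_formallyUnramified (A F : Type*) [CommRing A] [CommRing F]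
    [Algebra A F] [Algebra.FormallyUnramified A F] [Algebra.EssFiniteType A F] :
    Algebra.QuasiFinite A F where
  finite_fiber P _ := Algebra.FormallyUnramified.finite_of_free P.ResidueField (P.Fiber F)

/-- The Krull dimension does not increase along quasi-finite algebras. -/
lemma Algebra.QuasiFinite.ringKrullDim_le (A F : Type*) [CommRing A] [CommRing F]
    [Algebra A F] [Algebra.QuasiFinite A F] : ringKrullDim F ≤ ringKrullDim A := by
  refine Order.krullDim_le_of_strictMono (PrimeSpectrum.comap (algebraMap A F)) fun P Q h ↦ ?_
  refine lt_of_le_of_ne (Ideal.comap_mono h.le) fun heq ↦ h.ne ?_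
  exact PrimeSpectrum.ext (Algebra.QuasiFinite.eq_of_le_of_under_eq (R := A) P.asIdeal Q.asIdeal
    h.le congr($(heq).asIdeal))

/-- The Krull dimension does not decrease along injective integral algebras. -/
lemma Algebra.IsIntegral.le_ringKrullDim (A F : Type*) [CommRing A] [CommRing F]
    [Algebra A F] [Algebra.IsIntegral A F] (h : Function.Injective (algebraMap A F)) :
    ringKrullDim A ≤ ringKrullDim F := by
  refine iSup_le fun l ↦ ?_
  obtain ⟨P, hP, hPl⟩ := Ideal.exists_ideal_over_prime_of_isIntegral (S := F) l.head.asIdeal ⊥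
    (by simp [← RingHom.ker_eq_comap_bot, (RingHom.injective_iff_ker_eq_bot _).mp h])
  have : P.IsPrime := hPl.1
  have : P.LiesOver l.head.asIdeal := ⟨hPl.2.symm⟩
  obtain ⟨L, hL, -⟩ := Ideal.exists_ltSeries_of_hasGoingUp l P
  rw [← hL]
  exact le_iSup (fun L : LTSeries (PrimeSpectrum F) ↦ (L.length : WithBot ℕ∞)) L

lemma ringKrullDim_mvPolynomial_fin (k : Type*) [Field k] (n : ℕ) :
    ringKrullDim (MvPolynomial (Fin n) k) = n := by
  simp [MvPolynomial.ringKrullDim_of_isNoetherianRing]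

/-- Noether normalization, with a bound on the number of variables. -/
lemma exists_algHom_finite_and_le_ringKrullDim (k F : Type*) [Field k] [CommRing F] [Nontrivial F]
    [Algebra k F] [Algebra.FiniteType k F] :
    ∃ (d : ℕ) (g : MvPolynomial (Fin d) k →ₐ[k] F), g.Finite ∧ (d : WithBot ℕ∞) ≤ ringKrullDim F := by
  obtain ⟨d, g, hinj, hfin⟩ := exists_finite_inj_algHom_of_fg k F
  refine ⟨d, g, hfin, ?_⟩
  algebraize [g.toRingHom]
  have : Module.Finite (MvPolynomial (Fin d) k) F := hfin
  rw [← ringKrullDim_mvPolynomial_fin k d]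
  exact Algebra.IsIntegral.le_ringKrullDim _ _ hinj

end Dimension

/-! ### Differentials as coordinates: dimension against rank over a field. -/

section Coordinates

/-- If `Ω` is free of rank `n` at a prime `q`, there are `n` functions whose differentials
generate it, hence an algebra structure over the polynomial ring unramified at `q`. -/
lemma Algebra.exists_isUnramifiedAt_mvPolynomial {R S : Type*} [CommRing R] [CommRing S]
    [Algebra R S] [Algebra.FiniteType R S] (q : Ideal S) [q.IsPrime] {n : ℕ}
    [Module.Free (Localization.AtPrime q) Ω[Localization.AtPrime q⁄R]]
    (hn : Module.finrank (Localization.AtPrime q) Ω[Localization.AtPrime q⁄R] = n) :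
    ∃ (_ : Algebra (MvPolynomial (Fin n) R) S) (_ : IsScalarTower R (MvPolynomial (Fin n) R) S),
      Algebra.IsUnramifiedAt (MvPolynomial (Fin n) R) q := by
  let Sq := Localization.AtPrime q
  have : Algebra.EssFiniteType S Sq := .of_isLocalization _ q.primeCompl
  have : Algebra.EssFiniteType R Sq := .comp _ S _
  have : Module.FinitePresentation Sq Ω[Sq⁄R] := Module.finitePresentation_of_projective _ _
  -- Differentials of elements of `S` already span, so over the local ring a basis can be chosen
  -- among them.
  obtain ⟨κ, a, b, hb⟩ := Module.exists_basis_of_span_of_flat _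
    (KaehlerDifferential.span_range_map_derivation_of_isLocalization R S Sq q.primeCompl)
  have : Finite κ := Module.Finite.finite_basis b
  have := Fintype.ofFinite κ
  have e : κ ≃ Fin n := Fintype.equivFinOfCardEq (by rw [← hn, Module.finrank_eq_card_basis b])
  let g : MvPolynomial (Fin n) R →ₐ[R] S := MvPolynomial.aeval fun i ↦ a (e.symm i)
  let _ := g.toRingHom.toAlgebra
  have : IsScalarTower R (MvPolynomial (Fin n) R) S := .of_algebraMap_eq' g.comp_algebraMap.symm
  refine ⟨inferInstance, inferInstance, ?_⟩
  refine (Algebra.formallyUnramified_iff _ _).mpr ?_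
  -- The surjection onto the differentials relative to the polynomial ring kills every `d (a i)`,
  -- since `a i` is the image of a variable; these form a basis, so the target vanishes.
  have hz (x : Ω[Sq⁄R]) :
      KaehlerDifferential.map R (MvPolynomial (Fin n) R) Sq Sq x = 0 := by
    have hx : x ∈ Submodule.span Sq (Set.range b) := by rw [b.span_eq]; trivial
    induction hx using Submodule.span_induction with
    | mem x h =>
      obtain ⟨i, rfl⟩ := h
      rw [hb]
      rw [Function.comp_apply, KaehlerDifferential.map_D, KaehlerDifferential.map_D,
        Algebra.algebraMap_self, RingHom.id_apply]
      have : a i = algebraMap (MvPolynomial (Fin n) R) S (MvPolynomial.X (e i)) := by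
        simp [RingHom.algebraMap_toAlgebra, g]
      rw [this, ← IsScalarTower.algebraMap_apply]
      simp
    | zero => simp
    | add x y _ _ hx hy => simp [hx, hy]
    | smul c x _ hx => simp [hx]
  refine subsingleton_of_forall_eq 0 fun y ↦ ?_
  obtain ⟨x, rfl⟩ := KaehlerDifferential.map_surjective R (MvPolynomial (Fin n) R) Sq y
  exact hz x

variable {k F : Type*} [Field k] [CommRing F] [Algebra k F] [Algebra.FiniteType k F]
  (q : Ideal F) [q.IsPrime] {n : ℕ}
  [Module.Free (Localization.AtPrime q) Ω[Localization.AtPrime q⁄k]]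

/-- The local dimension is at most the rank of the module of differentials. -/
lemma Algebra.exists_ringKrullDim_away_le_of_finrank_kaehlerDifferential
    (hn : Module.finrank (Localization.AtPrime q) Ω[Localization.AtPrime q⁄k] = n) :
    ∃ g ∉ q, ringKrullDim (Localization.Away g) ≤ n := by
  obtain ⟨_, _, _⟩ := Algebra.exists_isUnramifiedAt_mvPolynomial (R := k) q hn
  have : Algebra.FiniteType (MvPolynomial (Fin n) k) F := .of_restrictScalars_finiteType k _ _
  obtain ⟨g, hg, _⟩ := Algebra.exists_unramified_of_isUnramifiedAt (R := MvPolynomial (Fin n) k) q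
  refine ⟨g, hg, ?_⟩
  have := Algebra.QuasiFinite.of_formallyUnramified (MvPolynomial (Fin n) k) (Localization.Away g)
  rw [← ringKrullDim_mvPolynomial_fin k n]
  exact Algebra.QuasiFinite.ringKrullDim_le _ _

/-- At a non-smooth point, the local dimension is less than the rank of the module of
differentials. -/
lemma Algebra.exists_ringKrullDim_away_lt_of_not_isSmoothAt
    (hn : Module.finrank (Localization.AtPrime q) Ω[Localization.AtPrime q⁄k] = n)
    (hq : ¬ Algebra.IsSmoothAt k q) :
    ∃ g ∉ q, ringKrullDim (Localization.Away g) < n := by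
  let P := MvPolynomial (Fin n) k
  obtain ⟨_, _, _⟩ := Algebra.exists_isUnramifiedAt_mvPolynomial (R := k) q hn
  have : Algebra.FiniteType P F := .of_restrictScalars_finiteType k _ _
  have hninj : ¬ Function.Injective (algebraMap P (Localization.AtPrime q)) := by
    intro hinj
    have := Algebra.IsUnramifiedAt.isEtaleAt_of_injective q hinj
    exact hq (.comp k P (Localization.AtPrime q))
  rw [injective_iff_map_eq_zero] at hninj
  push Not at hninj
  obtain ⟨c, hc, hc0⟩ := hninj
  rw [IsScalarTower.algebraMap_apply P F, IsLocalization.map_eq_zero_iff q.primeCompl] at hc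
  -- The nonzero polynomial `c` dies in the local ring at `q`, hence after inverting a single `s ∉
  -- q`. Inverting also `g` keeps the map unramified.
  obtain ⟨⟨s, hs⟩, hsc⟩ := hc
  obtain ⟨g, hg, hgu⟩ := Algebra.exists_unramified_of_isUnramifiedAt (R := P) q
  have hu : Algebra.FormallyUnramified P (Localization.Away (g * s)) :=
    Algebra.basicOpen_subset_unramifiedLocus_iff.mp
      (subset_trans (PrimeSpectrum.basicOpen_mul_le_left g s)
        (Algebra.basicOpen_subset_unramifiedLocus_iff.mpr hgu.1))
  refine ⟨g * s, ‹q.IsPrime›.mul_notMem hg hs, ?_⟩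
  have : Algebra.EssFiniteType F (Localization.Away (g * s)) :=
    .of_isLocalization _ (.powers (g * s))
  have : Algebra.EssFiniteType P (Localization.Away (g * s)) := .comp _ F _
  have := Algebra.QuasiFinite.of_formallyUnramified P (Localization.Away (g * s))
  have hker : algebraMap P (Localization.Away (g * s)) c = 0 := by
    rw [IsScalarTower.algebraMap_apply P F, IsLocalization.map_eq_zero_iff (.powers (g * s))]
    refine ⟨⟨g * s, 1, pow_one _⟩, ?_⟩
    change g * s * _ = 0
    rw [mul_assoc, hsc, mul_zero]
  let φ : P ⧸ Ideal.span {c} →+* Localization.Away (g * s) :=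
    Ideal.Quotient.lift _ (algebraMap P _) fun a ha ↦ by
      obtain ⟨b, rfl⟩ := Ideal.mem_span_singleton.mp ha
      rw [map_mul, hker, zero_mul]
  let _ := φ.toAlgebra
  have : IsScalarTower P (P ⧸ Ideal.span {c}) (Localization.Away (g * s)) :=
    IsScalarTower.of_algebraMap_eq (R := P) (S := P ⧸ Ideal.span {c})
      (A := Localization.Away (g * s)) fun _ ↦ by
        simp [RingHom.algebraMap_toAlgebra, φ, Ideal.Quotient.algebraMap_eq]
  have := Algebra.QuasiFinite.of_restrictScalars P (P ⧸ Ideal.span {c}) (Localization.Away (g * s))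
  have h1 := Algebra.QuasiFinite.ringKrullDim_le (P ⧸ Ideal.span {c}) (Localization.Away (g * s))
  have h2 := ringKrullDim_quotient_succ_le_of_nonZeroDivisor
    (mem_nonZeroDivisors_of_ne_zero hc0)
  rw [ringKrullDim_mvPolynomial_fin k n] at h2
  have h3 := (add_le_add_left h1 1).trans h2
  generalize ringKrullDim (Localization.Away (g * s)) = x at h3 ⊢
  -- The value `⊥` must be split off since adding `1` does not change it; infinity is excluded by
  -- the bound `n`.
  induction x using WithBot.recBotCoe with
  | bot => exact WithBot.bot_lt_coe _
  | coe x =>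
    have h4 : x + 1 ≤ (n : ℕ∞) := WithBot.coe_le_coe.mp h3
    refine WithBot.coe_lt_coe.mpr ?_
    exact (ENat.add_one_le_iff (fun h ↦ by subst h; exact absurd h4 (by simp))).mp h4

end Coordinates

/-! ### Transcendence degree at a minimal prime. -/

section GenericPoint

variable {R S : Type u} [CommRing R] [CommRing S] [Algebra R S]

/-- At a minimal prime of a flat algebra over a polynomial ring, the variables are algebraically
independent over the base. -/
lemma MvPolynomial.algebraicIndependent_quotient_of_mem_minimalPrimes {n : ℕ}
    [Algebra (MvPolynomial (Fin n) R) S] [IsScalarTower R (MvPolynomial (Fin n) R) S]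
    [Module.Flat (MvPolynomial (Fin n) R) S] (P : Ideal S) (hP : P ∈ minimalPrimes S)
    (p : Ideal R) [P.LiesOver p] :
    AlgebraicIndependent (R ⧸ p) fun i : Fin n ↦
      (Ideal.Quotient.mk P (algebraMap (MvPolynomial (Fin n) R) S (X i)) : S ⧸ P) := by
  have : P.IsPrime := hP.1.1
  have : p.IsPrime := by rw [P.over_def p]; infer_instance
  let A := MvPolynomial (Fin n) R
  let f : A →+* MvPolynomial (Fin n) (R ⧸ p) := MvPolynomial.map (Ideal.Quotient.mk p)
  have hf : RingHom.ker f = p.map C := by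
    rw [MvPolynomial.ker_map, Ideal.mk_ker]
  have hprime : (p.map (C : R →+* A)).IsPrime := hf ▸ RingHom.ker_isPrime f
  have hle : p.map C ≤ P.under A := by
    rw [Ideal.map_le_iff_le_comap]
    intro r hr
    rw [P.over_def p] at hr
    rw [Ideal.mem_comap, Ideal.under_def, Ideal.mem_comap]
    change algebraMap A S (algebraMap R A r) ∈ P
    rwa [← IsScalarTower.algebraMap_apply]
  -- Going down along the flat map yields a prime below `P` lying over `p.map C`; minimality of `P`
  -- forces it to be `P`.
  have heq : P.under A = p.map C := by
    obtain ⟨P', hP', hprime', hover⟩ := Ideal.exists_ideal_le_liesOver_of_le (R := A) (S := S)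
      (p := p.map C) (q := P.under A) P hle
    have : P = P' := le_antisymm (hP.2 ⟨hprime', bot_le⟩ hP') hP'
    rw [this]
    exact hover.over.symm
  have key : (MvPolynomial.aeval (fun i : Fin n ↦
      (Ideal.Quotient.mk P (algebraMap A S (X i)) : S ⧸ P))).toRingHom.comp f =
        (Ideal.Quotient.mk P).comp (algebraMap A S) := by
    refine MvPolynomial.ringHom_ext (fun a ↦ ?_) fun i ↦ by simp [f]
    have : algebraMap A S (C a) = algebraMap R S a :=
      (IsScalarTower.algebraMap_apply R A S a).symm
    simp only [f, RingHom.comp_apply, map_C, AlgHom.toRingHom_eq_coe, RingHom.coe_coe, aeval_C,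
      this]
    rfl
  rw [algebraicIndependent_iff]
  intro g hg
  obtain ⟨h, rfl⟩ : ∃ h, f h = g :=
    MvPolynomial.map_surjective _ Ideal.Quotient.mk_surjective g
  replace key := congr($key h)
  change aeval _ (f h) = Ideal.Quotient.mk P (algebraMap A S h) at key
  rw [key, Ideal.Quotient.eq_zero_iff_mem] at hg
  rw [← RingHom.mem_ker, hf, ← heq]
  exact hg

/-- A domain is algebraic over a subdomain if a field extension of it is quasi-finite over a ring
mapping to the subdomain. -/
lemma Algebra.QuasiFinite.isAlgebraic_of_injective (B C D L : Type u) [CommRing B] [CommRing C]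
    [CommRing D] [Field L] [IsDomain C] [Algebra B C] [Algebra C D] [Algebra D L] [Algebra C L]
    [Algebra B L] [IsScalarTower B C L] [IsScalarTower C D L] [Algebra.QuasiFinite B L]
    (h : Function.Injective (algebraMap C D)) (h' : Function.Injective (algebraMap D L)) :
    Algebra.IsAlgebraic C D := by
  let K := FractionRing C
  have hinj : Function.Injective (algebraMap C L) := by
    rw [IsScalarTower.algebraMap_eq C D L]
    exact h'.comp h
  let ψ : K →+* L := IsFractionRing.lift hinj
  let _ := ψ.toAlgebra
  have : IsScalarTower C K L := .of_algebraMap_eq fun x ↦ by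
    simp [RingHom.algebraMap_toAlgebra, ψ, K]
  have : Algebra.QuasiFinite C L := .of_restrictScalars B C L
  have : Algebra.QuasiFinite K L := .of_restrictScalars C K L
  have : Module.Finite K L := .of_quasiFinite
  refine ⟨fun x ↦ ?_⟩
  have h : IsAlgebraic K (algebraMap D L x) :=
    (Algebra.IsIntegral.isIntegral (R := K) _).isAlgebraic
  rw [← IsFractionRing.isAlgebraic_iff C K L] at h
  exact (isAlgebraic_algHom_iff (IsScalarTower.toAlgHom C D L) h').mp h

/-- If an algebra is quasi-finite at a prime over a polynomial ring in `d` variables, then the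
residue domain has transcendence degree at most `d` over the base. -/
lemma MvPolynomial.trdeg_quotient_le_of_quasiFiniteAt {d : ℕ}
    [Algebra (MvPolynomial (Fin d) R) S] [IsScalarTower R (MvPolynomial (Fin d) R) S]
    (P : Ideal S) [P.IsPrime] [Algebra.QuasiFiniteAt (MvPolynomial (Fin d) R) P]
    (p : Ideal R) [P.LiesOver p] :
    Algebra.trdeg (R ⧸ p) (S ⧸ P) ≤ d := by
  let B := MvPolynomial (Fin d) R
  let L := P.ResidueField
  let s : Set (S ⧸ P) := Set.range fun i : Fin d ↦
      (Ideal.Quotient.mk P (algebraMap B S (X i)) : S ⧸ P)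
  let C := Algebra.adjoin (R ⧸ p) s
  have hmem (b : B) : algebraMap B (S ⧸ P) b ∈ C := by
    induction b using MvPolynomial.induction_on with
    | C a =>
      have : algebraMap B (S ⧸ P) (MvPolynomial.C a) =
          algebraMap (R ⧸ p) (S ⧸ P) (Ideal.Quotient.mk p a) := by
        change algebraMap B (S ⧸ P) (algebraMap R B a) = _
        rw [← IsScalarTower.algebraMap_apply]
        rfl
      rw [this]
      exact C.algebraMap_mem _
    | add a b ha hb => rw [map_add]; exact C.add_mem ha hb
    | mul_X a i ha =>
      rw [map_mul]
      exact C.mul_mem ha (Algebra.subset_adjoin ⟨i, rfl⟩)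
  let φ : B →+* C := (algebraMap B (S ⧸ P)).codRestrict C hmem
  have : Algebra.QuasiFinite B L :=
    .of_surjective_algHom (IsScalarTower.toAlgHom B (Localization.AtPrime P) L)
      IsLocalRing.residue_surjective
  -- The residue field at `P` is quasi-finite, hence finite, over the fraction field of the
  -- subalgebra `C` generated by the images of the `d` variables.
  have : Algebra.IsAlgebraic C (S ⧸ P) := by
    let _ : Algebra B C := φ.toAlgebra
    have h : IsScalarTower B C L := .of_algebraMap_eq' <| by
      rw [IsScalarTower.algebraMap_eq B (S ⧸ P) L]
      rfl
    exact Algebra.QuasiFinite.isAlgebraic_of_injective B C (S ⧸ P) L Subtype.val_injective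
      P.injective_algebraMap_quotient_residueField
  refine (Algebra.IsAlgebraic.trdeg_le_cardinalMk (R ⧸ p) s).trans ?_
  simpa [s] using Cardinal.mk_range_le_lift (f := fun i : Fin d ↦
    (Ideal.Quotient.mk P (algebraMap B S (X i)) : S ⧸ P))

/-- A flat algebra over a polynomial ring in `n` variables cannot be quasi-finite at a minimal
prime over a polynomial ring in fewer variables. -/
lemma MvPolynomial.le_of_flat_of_quasiFiniteAt {n d : ℕ}
    [Algebra (MvPolynomial (Fin n) R) S] [IsScalarTower R (MvPolynomial (Fin n) R) S]
    [Module.Flat (MvPolynomial (Fin n) R) S]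
    [Algebra (MvPolynomial (Fin d) R) S] [IsScalarTower R (MvPolynomial (Fin d) R) S]
    (P : Ideal S) (hP : P ∈ minimalPrimes S) [P.IsPrime]
    [Algebra.QuasiFiniteAt (MvPolynomial (Fin d) R) P] : n ≤ d := by
  have h1 := MvPolynomial.algebraicIndependent_quotient_of_mem_minimalPrimes (n := n) P hP
    (P.under R)
  have h2 := MvPolynomial.trdeg_quotient_le_of_quasiFiniteAt (d := d) P (P.under R)
  have h3 := h1.lift_cardinalMk_le_trdeg
  simpa using h3.trans (Cardinal.lift_le.mpr h2)

end GenericPoint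

/-! ### Transport of smoothness and rank along formally étale maps. -/

section Rank

variable {R S T : Type u} [CommRing R] [CommRing S] [CommRing T] [Algebra R S] [Algebra R T]
  [Algebra S T] [IsScalarTower R S T]

/-- Kähler differentials stay free along formally étale algebras. -/
lemma KaehlerDifferential.free_of_formallyEtale [Algebra.FormallyEtale S T]
    [Module.Free S Ω[S⁄R]] : Module.Free T Ω[T⁄R] :=
  .of_equiv (KaehlerDifferential.tensorKaehlerEquivOfFormallyEtale R S T)

/-- The rank of free Kähler differentials is preserved by formally étale algebras. -/
lemma KaehlerDifferential.finrank_of_formallyEtale [Algebra.FormallyEtale S T]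
    [Module.Free S Ω[S⁄R]] [Nontrivial T] :
    Module.finrank T Ω[T⁄R] = Module.finrank S Ω[S⁄R] := by
  rw [← (KaehlerDifferential.tensorKaehlerEquivOfFormallyEtale R S T).finrank_eq]
  have : Nontrivial S := (algebraMap S T).domain_nontrivial
  exact Module.finrank_baseChange

/-- A formally étale algebra inverting the complement of a prime is formally étale over the
localization. -/
lemma Localization.AtPrime.exists_formallyEtale [Algebra.FormallyEtale S T] (q : Ideal S)
    [q.IsPrime] (hq : ∀ x ∉ q, IsUnit (algebraMap S T x)) :
    ∃ _ : Algebra (Localization.AtPrime q) T, IsScalarTower R (Localization.AtPrime q) T ∧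
      Algebra.FormallyEtale (Localization.AtPrime q) T := by
  let f : Localization.AtPrime q →ₐ[S] T := IsLocalization.liftAlgHom (M := q.primeCompl)
    (f := Algebra.ofId S T) fun x ↦ hq x.1 x.2
  algebraize [f.toRingHom]
  have : IsScalarTower S (Localization.AtPrime q) T := .of_algebraMap_eq' f.comp_algebraMap.symm
  have : Algebra.FormallyEtale S (Localization.AtPrime q) := .of_isLocalization q.primeCompl
  exact ⟨inferInstance, .to₁₃₄ _ S _ _, .of_restrictScalars (R := S)⟩

lemma Algebra.IsSmoothAt.formallySmooth_of_formallyEtale [Algebra.FormallyEtale S T] (q : Ideal S)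
    [q.IsPrime] (hq : ∀ x ∉ q, IsUnit (algebraMap S T x)) [Algebra.IsSmoothAt R q] :
    Algebra.FormallySmooth R T := by
  obtain ⟨_, _, _⟩ := Localization.AtPrime.exists_formallyEtale (R := R) q hq
  exact .comp R (Localization.AtPrime q) T

/-- Used with `T` the local ring at a generisation of `q`: it is formally étale over the local ring
at `q`, so a free `Ω` keeps its rank. -/
lemma KaehlerDifferential.finrank_eq_finrank_atPrime [Algebra.FormallyEtale S T] [Nontrivial T]
    (q : Ideal S) [q.IsPrime] (hq : ∀ x ∉ q, IsUnit (algebraMap S T x))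
    [Module.Free (Localization.AtPrime q) Ω[Localization.AtPrime q⁄R]] :
    Module.finrank T Ω[T⁄R] =
      Module.finrank (Localization.AtPrime q) Ω[Localization.AtPrime q⁄R] := by
  obtain ⟨_, _, _⟩ := Localization.AtPrime.exists_formallyEtale (R := R) q hq
  exact finrank_of_formallyEtale (S := Localization.AtPrime q)

end Rank

/-! ### At smooth points the rank is at most the dimension. -/

section Smooth

variable {R S : Type u} [CommRing R] [CommRing S] [Algebra R S]

lemma IsLocalization.AtPrime.maximalIdeal_mem_minimalPrimes (P : Ideal S) [P.IsPrime]
    (hP : P ∈ minimalPrimes S) :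
    IsLocalRing.maximalIdeal (Localization.AtPrime P) ∈ minimalPrimes (Localization.AtPrime P) := by
  refine ⟨⟨inferInstance, bot_le⟩, fun Q hQ hle ↦ ?_⟩
  have := hQ.1
  rw [← IsLocalization.map_under P.primeCompl (Localization.AtPrime P) Q,
    ← IsLocalization.map_under P.primeCompl (Localization.AtPrime P)
      (IsLocalRing.maximalIdeal (Localization.AtPrime P))]
  refine Ideal.map_mono ?_
  rw [IsLocalization.AtPrime.under_maximalIdeal (Localization.AtPrime P) P]
  refine hP.2 ⟨inferInstance, bot_le⟩ ?_
  conv_rhs => rw [← IsLocalization.AtPrime.under_maximalIdeal (Localization.AtPrime P) P]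
  exact Ideal.comap_mono hle

/-- At a minimal prime where it is smooth of relative dimension `n`, an algebra cannot be
quasi-finite over a polynomial ring in fewer than `n` variables. -/
lemma Algebra.IsSmoothAt.finrank_le_of_quasiFiniteAt {d : ℕ} [Algebra.FinitePresentation R S]
    (P : Ideal S) [P.IsPrime] (hP : P ∈ minimalPrimes S) [Algebra.IsSmoothAt R P]
    [Algebra (MvPolynomial (Fin d) R) S] [IsScalarTower R (MvPolynomial (Fin d) R) S]
    [Algebra.QuasiFiniteAt (MvPolynomial (Fin d) R) P] :
    Module.finrank (Localization.AtPrime P) Ω[Localization.AtPrime P⁄R] ≤ d := by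
  obtain ⟨f, hf, m, _, _, _⟩ :=
    Algebra.IsSmoothAt.exists_isStandardEtale_mvPolynomial (R := R) (p := P)
  let A := MvPolynomial (Fin m) R
  let T := Localization.Away f
  let SP := Localization.AtPrime P
  let φ : T →ₐ[S] SP := IsLocalization.liftAlgHom (M := .powers f) (f := Algebra.ofId S SP) <| by
    rintro ⟨_, k, rfl⟩
    exact IsLocalization.map_units SP (⟨f ^ k, P.primeCompl.pow_mem hf k⟩ : P.primeCompl)
  algebraize [φ.toRingHom, φ.toRingHom.comp (algebraMap A T)]
  have : IsScalarTower S T SP := .of_algebraMap_eq' φ.comp_algebraMap.symm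
  have : IsScalarTower R T SP := .to₁₃₄ _ S _ _
  have : IsScalarTower R A SP := .to₁₂₄ _ _ T _
  have : Algebra.FormallyEtale S SP := .of_isLocalization P.primeCompl
  have : Algebra.FormallyEtale S T := .of_isLocalization (.powers f)
  have : Algebra.FormallyEtale T SP := .of_restrictScalars (R := S)
  have : Algebra.FormallyEtale A SP := .comp A T SP
  have : IsLocalization (Algebra.algebraMapSubmonoid T P.primeCompl) SP :=
    .isLocalization_of_submonoid_le _ _ (.powers f) _ ((Submonoid.powers_le).mpr hf)
  have : Module.Flat T SP := IsLocalization.flat SP (Algebra.algebraMapSubmonoid T P.primeCompl)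
  have : Module.Flat A SP := .trans A T SP
  have : Nontrivial A := (algebraMap A SP).domain_nontrivial
  rw [KaehlerDifferential.finrank_of_formallyEtale (S := A),
    Module.finrank_eq_card_basis (KaehlerDifferential.mvPolynomialBasis R (Fin m)),
    Fintype.card_fin]
  -- Flatness over the polynomial ring is available for `SP` only, not for `S`. The comparison of
  -- variables is therefore made for the ring `SP` at its own maximal ideal, which is a minimal
  -- prime.
  have : Algebra.QuasiFinite SP (Localization.AtPrime (IsLocalRing.maximalIdeal SP)) :=
    .of_isLocalization (IsLocalRing.maximalIdeal SP).primeCompl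
  have : Algebra.QuasiFiniteAt (MvPolynomial (Fin d) R) (IsLocalRing.maximalIdeal SP) :=
    .trans _ SP _
  exact MvPolynomial.le_of_flat_of_quasiFiniteAt (R := R) (n := m) (d := d) (IsLocalRing.maximalIdeal SP)
    (IsLocalization.AtPrime.maximalIdeal_mem_minimalPrimes P hP)

/-- The local dimension at a smooth point of an algebra over a field is at least the rank of the
module of differentials. -/
lemma Algebra.IsSmoothAt.finrank_le_ringKrullDim_away {k F : Type u} [Field k] [CommRing F]
    [Algebra k F] [Algebra.FiniteType k F] (q : Ideal F) [q.IsPrime] [Algebra.IsSmoothAt k q]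
    [Module.Free (Localization.AtPrime q) Ω[Localization.AtPrime q⁄k]] {g : F} (hg : g ∉ q) :
    (Module.finrank (Localization.AtPrime q) Ω[Localization.AtPrime q⁄k] : WithBot ℕ∞) ≤
      ringKrullDim (Localization.Away g) := by
  let T := Localization.Away g
  have hdisj : Disjoint (Submonoid.powers g : Set F) q :=
    (Ideal.disjoint_powers_iff_notMem_of_isPrime g).mpr hg
  have hqT : (q.map (algebraMap F T)).IsPrime :=
    IsLocalization.isPrime_of_isPrime_disjoint (.powers g) T q ‹_› hdisj
  -- The rank is computed at a generic point `P` of the basic open set specialising to `q`, where it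
  -- can be compared with a Noether normalisation.
  obtain ⟨P, hP, hPq⟩ := Ideal.exists_minimalPrimes_le (J := q.map (algebraMap F T)) bot_le
  have hP' : P ∈ minimalPrimes T := hP
  have : P.IsPrime := hP.1.1
  have : Nontrivial T := ⟨0, 1, fun h ↦ hqT.1 ((Ideal.eq_top_iff_one _).mpr (h ▸ zero_mem _))⟩
  have hle : P.under F ≤ q := by
    rw [← IsLocalization.under_map_of_isPrime_disjoint (.powers g) T (I := q) ‹_› hdisj]
    exact Ideal.comap_mono hPq
  let TP := Localization.AtPrime P
  have hunit (x : F) (hx : x ∉ q) : IsUnit (algebraMap F TP x) := by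
    rw [IsScalarTower.algebraMap_apply F T TP]
    exact IsLocalization.map_units TP (⟨_, fun h ↦ hx (hle h)⟩ : P.primeCompl)
  have : Algebra.FiniteType k T := .trans ‹_› (IsLocalization.finiteType_of_monoid_fg (.powers g) T)
  have : Algebra.FinitePresentation k T := Algebra.FinitePresentation.of_finiteType.mp ‹_›
  have : Algebra.FormallyEtale F T := .of_isLocalization (.powers g)
  have : Algebra.FormallyEtale T TP := .of_isLocalization P.primeCompl
  have : Algebra.FormallyEtale F TP := .comp F T TP
  have : Algebra.IsSmoothAt k P :=
    Algebra.IsSmoothAt.formallySmooth_of_formallyEtale q hunit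
  rw [← KaehlerDifferential.finrank_eq_finrank_atPrime (T := TP) q hunit]
  obtain ⟨d, φ, hφ, hd⟩ := exists_algHom_finite_and_le_ringKrullDim k T
  refine le_trans ?_ hd
  algebraize [φ.toRingHom]
  have : Module.Finite (MvPolynomial (Fin d) k) T := hφ
  have : IsScalarTower k (MvPolynomial (Fin d) k) T := .of_algebraMap_eq' φ.comp_algebraMap.symm
  have : Algebra.QuasiFinite T TP := .of_isLocalization P.primeCompl
  have : Algebra.QuasiFiniteAt (MvPolynomial (Fin d) k) P := .trans _ T _
  exact_mod_cast Algebra.IsSmoothAt.finrank_le_of_quasiFiniteAt (R := k) (d := d) P hP'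

end Smooth

/-! ### Smoothness and differentials under base change. -/

section BaseChange

variable {R S K F : Type u} [CommRing R] [CommRing S] [CommRing K] [CommRing F]
  [Algebra R S] [Algebra R K] [Algebra R F] [Algebra S F] [Algebra K F] [IsScalarTower R S F]
  [IsScalarTower R K F] [Algebra.IsPushout R K S F]
  (q : Ideal S) (Q : Ideal F) [q.IsPrime] [Q.IsPrime] [Q.LiesOver q]

/-- After a base change, the local ring at a prime over `q` is formally étale over the base change
of the local ring at `q`. -/
lemma Localization.AtPrime.exists_isPushout_formallyEtale :
    ∃ (T : Type u) (_ : CommRing T) (_ : Algebra R T) (_ : Algebra K T)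
      (_ : Algebra (Localization.AtPrime q) T) (_ : Algebra T (Localization.AtPrime Q))
      (_ : IsScalarTower R K T) (_ : IsScalarTower R (Localization.AtPrime q) T),
      Algebra.IsPushout R K (Localization.AtPrime q) T ∧
      IsScalarTower K T (Localization.AtPrime Q) ∧
      Algebra.FormallyEtale T (Localization.AtPrime Q) := by
  let Sq := Localization.AtPrime q
  let FQ := Localization.AtPrime Q
  let f : Sq →ₐ[S] FQ := IsLocalization.liftAlgHom (M := q.primeCompl)
    (f := Algebra.ofId S FQ) <| by
      rintro ⟨s, hs⟩
      have h : Algebra.ofId S FQ s = algebraMap F FQ (algebraMap S F s) :=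
        IsScalarTower.algebraMap_apply S F FQ s
      rw [h]
      refine IsLocalization.map_units FQ (⟨algebraMap S F s, fun h ↦ hs ?_⟩ : Q.primeCompl)
      rwa [Q.over_def q]
  -- `T` is also `K ⊗ Sq`. Both `T` and `FQ` are formally étale over `F`, hence `FQ` is so over `T`.
  let T := F ⊗[S] Sq
  let φ : T →ₐ[F] FQ :=
    Algebra.TensorProduct.lift (Algebra.ofId F FQ) f fun _ _ ↦ .all _ _
  algebraize [φ.toRingHom]
  let _ : Algebra Sq T := Algebra.TensorProduct.rightAlgebra
  have : IsScalarTower F T FQ := .of_algebraMap_eq' φ.comp_algebraMap.symm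
  have : Algebra.FormallyEtale S Sq := .of_isLocalization q.primeCompl
  have : Algebra.FormallyEtale F FQ := .of_isLocalization Q.primeCompl
  have : Algebra.FormallyEtale T FQ := .of_restrictScalars (R := F)
  have : IsScalarTower K T FQ := .to₁₃₄ K F T FQ
  have : IsScalarTower R S T := .to₁₂₄ R S F T
  have : IsScalarTower R Sq T := .to₁₃₄ R S Sq T
  have : Algebra.IsPushout R S K F := .symm ‹_›
  have : Algebra.IsPushout S Sq F T := .symm inferInstance
  have : Algebra.IsPushout R Sq K T :=
    (Algebra.IsPushout.comp_iff (R := R) (S := S) (T := Sq) (R' := K) (S' := F) (T' := T)).mpr this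
  exact ⟨T, inferInstance, inferInstance, inferInstance, inferInstance, inferInstance,
    inferInstance, inferInstance, .symm this, inferInstance, inferInstance⟩

lemma Algebra.IsSmoothAt.of_isPushout [Algebra.IsSmoothAt R q] : Algebra.IsSmoothAt K Q := by
  obtain ⟨T, _, _, _, _, _, _, _, _, _, _⟩ :=
    Localization.AtPrime.exists_isPushout_formallyEtale (R := R) (K := K) q Q
  have : Algebra.FormallySmooth K T :=
    .of_equiv (Algebra.IsPushout.equiv R K (Localization.AtPrime q) T)
  exact .comp K T _

lemma KaehlerDifferential.free_atPrime_of_isPushout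
    [Module.Free (Localization.AtPrime q) Ω[Localization.AtPrime q⁄R]] :
    Module.Free (Localization.AtPrime Q) Ω[Localization.AtPrime Q⁄K] := by
  obtain ⟨T, _, _, _, _, _, _, _, _, _, _⟩ :=
    Localization.AtPrime.exists_isPushout_formallyEtale (R := R) (K := K) q Q
  have : Module.Free T Ω[T⁄K] :=
    .of_equiv (KaehlerDifferential.tensorKaehlerEquiv R K (Localization.AtPrime q) T)
  exact free_of_formallyEtale (S := T)

lemma KaehlerDifferential.finrank_atPrime_of_isPushout
    [Module.Free (Localization.AtPrime q) Ω[Localization.AtPrime q⁄R]] :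
    Module.finrank (Localization.AtPrime Q) Ω[Localization.AtPrime Q⁄K] =
      Module.finrank (Localization.AtPrime q) Ω[Localization.AtPrime q⁄R] := by
  obtain ⟨T, _, _, _, _, _, _, _, _, _, _⟩ :=
    Localization.AtPrime.exists_isPushout_formallyEtale (R := R) (K := K) q Q
  have e := KaehlerDifferential.tensorKaehlerEquiv R K (Localization.AtPrime q) T
  have : Module.Free T Ω[T⁄K] := .of_equiv e
  have : Nontrivial T := (algebraMap T (Localization.AtPrime Q)).domain_nontrivial
  rw [finrank_of_formallyEtale (S := T), ← e.finrank_eq]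
  exact Module.finrank_baseChange

end BaseChange

/-! ### Descent of smoothness from the fibre. -/

section Fiber

variable {R S K F : Type u} [CommRing R] [CommRing S] [Field K] [CommRing F]
  [Algebra R S] [Algebra R K] [Algebra R F] [Algebra S F] [Algebra K F] [IsScalarTower R S F]
  [IsScalarTower R K F] [Algebra.IsPushout R K S F]

/-- If the field `K` is generated by `R` as a field, then up to units of `K` every element of
`K ⊗ S` comes from `S`. -/
lemma Algebra.IsPushout.exists_algebraMap_mul_eq
    (hK : ∀ x : K, ∃ a s : R, algebraMap R K s ≠ 0 ∧ x * algebraMap R K s = algebraMap R K a)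
    (x : F) : ∃ r : R, algebraMap R K r ≠ 0 ∧ ∃ s : S, algebraMap R F r * x = algebraMap S F s := by
  induction x using (Algebra.IsPushout.out (R := R) (S := K) (R' := S) (S' := F)).inductionOn with
  | zero => exact ⟨1, by simp, 0, by simp⟩
  | tmul s => exact ⟨1, by simp, s, by simp⟩
  | smul c x hx =>
    obtain ⟨r, hr, s, h⟩ := hx
    obtain ⟨a, b, hb, hc⟩ := hK c
    refine ⟨r * b, by simp [hr, hb], algebraMap R S a * s, ?_⟩
    rw [map_mul (algebraMap S F), ← IsScalarTower.algebraMap_apply R S F,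
      IsScalarTower.algebraMap_apply R K F a, ← hc, ← h, Algebra.smul_def, map_mul, map_mul,
      ← IsScalarTower.algebraMap_apply R K F]
    ring
  | add x y hx hy =>
    obtain ⟨r, hr, s, h⟩ := hx
    obtain ⟨r', hr', s', h'⟩ := hy
    refine ⟨r * r', by simp [hr, hr'], algebraMap R S r' * s + algebraMap R S r * s', ?_⟩
    rw [map_add, map_mul, map_mul, map_mul (algebraMap S F),
      ← IsScalarTower.algebraMap_apply R S F, ← IsScalarTower.algebraMap_apply R S F, ← h, ← h']
    ring

/-- An algebra over `K ⊗ S` on which the complement of `q` is invertible inverts the complement of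
every prime of `K ⊗ S` over `q`. -/
lemma Algebra.IsPushout.isUnit_algebraMap_of_notMem
    (hK : ∀ x : K, ∃ a s : R, algebraMap R K s ≠ 0 ∧ x * algebraMap R K s = algebraMap R K a)
    (q : Ideal S) (Q : Ideal F) [Q.IsPrime] [Q.LiesOver q] {T : Type u} [CommRing T] [Algebra F T]
    (hT : ∀ s ∉ q, IsUnit (algebraMap F T (algebraMap S F s))) (x : F)
    (hx : x ∉ Q) : IsUnit (algebraMap F T x) := by
  obtain ⟨r, hr, s, h⟩ := Algebra.IsPushout.exists_algebraMap_mul_eq (S := S) hK x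
  have hr' : IsUnit (algebraMap R F r) := by
    rw [IsScalarTower.algebraMap_apply R K F]
    exact hr.isUnit.map _
  have hs : s ∉ q := by
    rw [Q.over_def q]
    change algebraMap S F s ∉ Q
    rw [← h]
    exact Q.primeCompl.mul_mem (fun h ↦ ‹Q.IsPrime›.1 (Q.eq_top_of_isUnit_mem h hr')) hx
  have := hT s hs
  rw [← h, map_mul] at this
  exact isUnit_of_mul_isUnit_right this

lemma Ideal.under_eq_ker_of_liesOver {R S K F : Type*} [CommRing R] [CommRing S] [Field K]
    [CommRing F] [Algebra R S] [Algebra R K] [Algebra R F] [Algebra S F] [Algebra K F]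
    [IsScalarTower R S F] [IsScalarTower R K F] (q : Ideal S) (Q : Ideal F) [Q.IsPrime]
    [Q.LiesOver q] : q.under R = RingHom.ker (algebraMap R K) := by
  have := Ideal.IsPrime.under K Q
  rw [Q.over_def q, Ideal.under_under, ← Ideal.under_under (A := R) (B := K) Q,
    Ideal.eq_bot_of_prime (Q.under K)]
  rfl

/-- A field generated by `R` is the residue field at the kernel. -/
lemma Ideal.ResidueField.exists_algEquiv {R K : Type*} [CommRing R] [Field K] [Algebra R K]
    (hK : ∀ x : K, ∃ a s : R, algebraMap R K s ≠ 0 ∧ x * algebraMap R K s = algebraMap R K a)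
    (p : Ideal R) [p.IsPrime] (hp : p = RingHom.ker (algebraMap R K)) :
    Nonempty (p.ResidueField ≃ₐ[R] K) := by
  let e₀ : p.ResidueField →ₐ[R] K :=
    Ideal.ResidueField.liftₐ p (Algebra.ofId R K) hp.le fun x hx ↦ by
      have : algebraMap R K x ≠ 0 := fun h ↦ hx (by rwa [hp])
      exact this.isUnit
  refine ⟨.ofBijective e₀ ⟨e₀.toRingHom.injective, fun x ↦ ?_⟩⟩
  obtain ⟨a, s, hs, h⟩ := hK x
  refine ⟨algebraMap R _ a / algebraMap R _ s, ?_⟩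
  rw [map_div₀, e₀.commutes, e₀.commutes, ← h, mul_div_cancel_right₀ _ hs]

/-- A flat algebra of finite presentation is smooth at a prime if its fibre is. -/
lemma Algebra.IsSmoothAt.of_isSmoothAt_fiber
    (hK : ∀ x : K, ∃ a s : R, algebraMap R K s ≠ 0 ∧ x * algebraMap R K s = algebraMap R K a)
    (q : Ideal S) (Q : Ideal F) [q.IsPrime] [Q.IsPrime] [Q.LiesOver q]
    [Algebra.FinitePresentation R S] [Module.Flat R (Localization.AtPrime q)]
    [Algebra.IsSmoothAt K Q] : Algebra.IsSmoothAt R q := by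
  have hker := Ideal.under_eq_ker_of_liesOver (R := R) (K := K) q Q
  obtain ⟨p, hp⟩ : ∃ p, p = q.under R := ⟨_, rfl⟩
  have : p.IsPrime := hp ▸ inferInstance
  have : q.LiesOver p := ⟨hp⟩
  rw [← hp] at hker
  -- The fibral criterion for formal smoothness is applied over a local base, so `R` is replaced by
  -- its localisation at `p`; flatness of `Sq` is unaffected.
  let Rp := Localization.AtPrime p
  let Sp := Localization (algebraMapSubmonoid S p.primeCompl)
  let Sq := Localization.AtPrime q
  let := Localization.AtPrime.algebraOfLiesOver p q
  let f : Sp →ₐ[S] Sq := IsLocalization.liftAlgHom (M := algebraMapSubmonoid S p.primeCompl)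
        (f := Algebra.ofId _ _) (by
      rintro ⟨_, x, hx, rfl⟩
      simpa using! IsLocalization.map_units (M := q.primeCompl) Sq ⟨algebraMap _ _ x,
        fun h ↦ hx (by rwa [q.over_def p])⟩)
  algebraize [f.toRingHom]
  have : IsScalarTower R Sp Sq := .to₁₃₄ _ S _ _
  have : IsScalarTower Rp Sp Sq := .of_algebraMap_eq' <| by
    apply IsLocalization.ringHom_ext p.primeCompl
    simp only [RingHom.comp_assoc, ← IsScalarTower.algebraMap_eq]
  have : IsLocalization (algebraMapSubmonoid Sp q.primeCompl) Sq :=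
    .isLocalization_of_submonoid_le _ _ (algebraMapSubmonoid S p.primeCompl) _
    (by rintro _ ⟨x, hx, rfl⟩; exact fun h ↦ hx (by rwa [q.over_def p]))
  have : Algebra.FinitePresentation Rp Sp := by
    have : Algebra.IsPushout R Rp S Sp :=
      .symm <| Algebra.isPushout_of_isLocalization p.primeCompl _ _ _
    exact .equiv (Algebra.IsPushout.equiv R Rp S Sp)
  have : Module.Flat Rp Sq := (Module.flat_iff_of_isLocalization Rp p.primeCompl Sq).mpr ‹_›
  let k := p.ResidueField
  obtain ⟨e⟩ : Nonempty (k ≃ₐ[R] K) := Ideal.ResidueField.exists_algEquiv hK p hker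
  have : Algebra.FormallyEtale S Sq := .of_isLocalization q.primeCompl
  let T := F ⊗[S] Sq
  let _ : Algebra Sq T := Algebra.TensorProduct.rightAlgebra
  -- Elements of `F` come from `S` up to units, so inverting the complement of `q` inverts that of
  -- `Q`: `T` factors through the local ring at `Q`.
  have : Algebra.FormallySmooth K T := by
    refine Algebra.IsSmoothAt.formallySmooth_of_formallyEtale Q fun x hx ↦
      Algebra.IsPushout.isUnit_algebraMap_of_notMem hK q Q (fun s hs ↦ ?_) x hx
    rw [← IsScalarTower.algebraMap_apply S F, IsScalarTower.algebraMap_apply S Sq]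
    exact (IsLocalization.map_units Sq (⟨s, hs⟩ : q.primeCompl)).map _
  have : Algebra.FormallySmooth k (k ⊗[Rp] Sq) := by
    have : IsScalarTower R S T := .to₁₂₄ R S F T
    have : IsScalarTower R Sq T := .to₁₃₄ R S Sq T
    have : Algebra.IsPushout R S K F := .symm ‹_›
    have : Algebra.IsPushout S Sq F T := .symm inferInstance
    have : Algebra.IsPushout R Sq K T :=
      (Algebra.IsPushout.comp_iff (R := R) (S := S) (T := Sq) (R' := K) (S' := F) (T' := T)).mpr
        this
    have : Algebra.IsPushout R K Sq T := .symm this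
    let e₁ : T ≃ₐ[R] k ⊗[Rp] Sq :=
      ((Algebra.IsPushout.equiv R K Sq T).symm.restrictScalars R).trans <|
      (Algebra.TensorProduct.congr e.symm (.refl (R := R))).trans <|
      Algebra.TensorProduct.equivOfCompatibleSMul ..
    have he₁ : (e₁.toRingHom.comp (algebraMap K T)).comp e.toRingHom =
        algebraMap k (k ⊗[Rp] Sq) := by
      ext x
      simp [e₁]
      rfl
    rw [← RingHom.formallySmooth_algebraMap, ← he₁]
    exact .comp (.of_bijective e.bijective)
      (.comp (RingHom.formallySmooth_algebraMap.mpr inferInstance) (.of_bijective e₁.bijective))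
  have := Algebra.FormallySmooth.of_formallySmooth_residueField_tensor
    (R := Rp) (S := Sq) (P := Sp) (Algebra.algebraMapSubmonoid _ q.primeCompl)
  exact .comp R Rp Sq

end Fiber

/-! ### From a generic point to its specialisations. -/

section SmoothFiber

variable {R S K F : Type u} [CommRing R] [CommRing S] [Field K] [CommRing F]
  [Algebra R S] [Algebra R K] [Algebra R F] [Algebra S F] [Algebra K F] [IsScalarTower R S F]
  [IsScalarTower R K F] [Algebra.IsPushout R K S F]

attribute [local instance] MvPolynomial.algebraMvPolynomial

lemma MvPolynomial.quasiFinite_of_quasiFinite {σ : Type*} [Algebra.QuasiFinite R K] :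
    Algebra.QuasiFinite (MvPolynomial σ R) (MvPolynomial σ K) :=
  .of_surjective_algHom
    (Algebra.IsPushout.equiv R (MvPolynomial σ R) K (MvPolynomial σ K)).toAlgHom
    (Algebra.IsPushout.equiv R (MvPolynomial σ R) K (MvPolynomial σ K)).surjective

/-- Quasi-finiteness at a prime can be checked on the fibre over the base of the base. -/
lemma Algebra.WeaklyQuasiFiniteAt.of_quasiFinite_isPushout
    (hK : ∀ x : K, ∃ a s : R, algebraMap R K s ≠ 0 ∧ x * algebraMap R K s = algebraMap R K a)
    (q : Ideal S) (Q : Ideal F) [q.IsPrime] [Q.IsPrime] [Q.LiesOver q]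
    {A : Type u} [CommRing A] [Algebra R A] [Algebra A S] [IsScalarTower R A S] [Algebra A F]
    [IsScalarTower A S F] [Algebra.QuasiFinite A F] :
    Algebra.WeaklyQuasiFiniteAt A q := by
  rw [Algebra.weaklyQuasiFiniteAt_iff]
  let Sq := Localization.AtPrime q
  let L := Sq ⧸ (q.under A).map (algebraMap A Sq)
  obtain ⟨p, hp⟩ : ∃ p, p = q.under R := ⟨_, rfl⟩
  have : p.IsPrime := hp ▸ inferInstance
  have hker := Ideal.under_eq_ker_of_liesOver (R := R) (K := K) q Q
  rw [← hp] at hker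
  obtain ⟨e⟩ := Ideal.ResidueField.exists_algEquiv hK p hker
  -- In `L` the prime `p` becomes zero and its complement invertible, so `L` receives a map from `K`
  -- and hence from `F`. Up to units every element of `L` then comes from `F`, which is quasi-finite
  -- over `A`.
  let ψ : p.ResidueField →ₐ[R] L := Ideal.ResidueField.liftₐ p (Algebra.ofId R L)
    (fun r hr ↦ by
      change algebraMap R L r = 0
      rw [IsScalarTower.algebraMap_apply R Sq L, IsScalarTower.algebraMap_apply R A Sq]
      refine Ideal.Quotient.eq_zero_iff_mem.mpr (Ideal.mem_map_of_mem _ ?_)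
      rw [hp] at hr
      change algebraMap A S (algebraMap R A r) ∈ q
      rwa [← IsScalarTower.algebraMap_apply])
    (fun r hr ↦ by
      change IsUnit (algebraMap R L r)
      rw [IsScalarTower.algebraMap_apply R Sq L, IsScalarTower.algebraMap_apply R S Sq]
      refine (IsLocalization.map_units Sq (⟨algebraMap R S r, fun h ↦ hr ?_⟩ : q.primeCompl)).map _
      rwa [hp])
  let f₀ : F →ₐ[R] L := Algebra.pushoutDesc F (ψ.comp e.symm.toAlgHom)
    (IsScalarTower.toAlgHom R S L) fun _ _ ↦ mul_comm _ _
  have hf₀ (s : S) : f₀ (algebraMap S F s) = algebraMap S L s :=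
    Algebra.pushoutDesc_right F _ _ _ s
  let f : F →ₐ[A] L := ⟨f₀.toRingHom, fun a ↦ by
    change f₀ (algebraMap A F a) = _
    rw [IsScalarTower.algebraMap_apply A S F, hf₀, ← IsScalarTower.algebraMap_apply A S L]⟩
  refine .of_forall_exists_mul_mem_range f fun x ↦ ?_
  obtain ⟨x, rfl⟩ := Ideal.Quotient.mk_surjective x
  obtain ⟨x, s, rfl⟩ := IsLocalization.exists_mk'_eq q.primeCompl x
  refine ⟨algebraMap S F s, ?_, algebraMap S F x, ?_⟩
  · change IsUnit (f₀ _)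
    rw [hf₀, IsScalarTower.algebraMap_apply S Sq L]
    exact (IsLocalization.map_units Sq s).map _
  · change f₀ _ = _ * f₀ _
    rw [hf₀, hf₀, IsScalarTower.algebraMap_apply S Sq L, IsScalarTower.algebraMap_apply S Sq L]
    change Ideal.Quotient.mk _ _ = Ideal.Quotient.mk _ _ * Ideal.Quotient.mk _ _
    rw [← map_mul, IsLocalization.mk'_spec]

/-- A finite map from a polynomial ring to the fibre can be lifted to a map to the algebra itself,
which is then quasi-finite along the fibre. -/
lemma Algebra.exists_quasiFiniteAt_mvPolynomial_of_finite_fiber [Algebra.FiniteType R S]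
    (hK : ∀ x : K, ∃ a s : R, algebraMap R K s ≠ 0 ∧ x * algebraMap R K s = algebraMap R K a)
    (q : Ideal S) (Q : Ideal F) [q.IsPrime] [Q.IsPrime] [Q.LiesOver q]
    {d : ℕ} (φ : MvPolynomial (Fin d) K →ₐ[K] F) (hφ : φ.Finite) :
    ∃ (_ : Algebra (MvPolynomial (Fin d) R) S) (_ : IsScalarTower R (MvPolynomial (Fin d) R) S),
      Algebra.QuasiFiniteAt (MvPolynomial (Fin d) R) q := by
  let A := MvPolynomial (Fin d) R
  let B := MvPolynomial (Fin d) K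
  choose r hr s hs using fun i : Fin d ↦
    Algebra.IsPushout.exists_algebraMap_mul_eq (S := S) hK (φ (.X i))
  let α : A →ₐ[R] S := MvPolynomial.aeval s
  let φ' : B →ₐ[K] F := MvPolynomial.aeval fun i ↦ algebraMap S F (s i)
  -- Since `s i` is `φ (X i)` times the unit `r i`, rescaling the variables turns `φ'` into `φ`.
  -- Unlike `φ`, the map `φ'` is induced by a map over `R`.
  have hφ' : φ'.Finite := by
    have h : φ'.comp (MvPolynomial.aeval fun i ↦
        MvPolynomial.C (algebraMap R K (r i))⁻¹ * MvPolynomial.X i) = φ := by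
      ext i
      simp only [AlgHom.comp_apply, MvPolynomial.aeval_X, map_mul, φ']
      rw [MvPolynomial.algHom_C, MvPolynomial.aeval_X, ← hs, IsScalarTower.algebraMap_apply R K F, ← mul_assoc, ← map_mul,
        inv_mul_cancel₀ (hr i), map_one, one_mul]
    refine RingHom.Finite.of_comp_finite (f := (MvPolynomial.aeval fun i ↦
        MvPolynomial.C (algebraMap R K (r i))⁻¹ * MvPolynomial.X i : B →ₐ[K] B).toRingHom) ?_
    rw [← h] at hφ
    exact hφ
  obtain ⟨p, hp⟩ : ∃ p, p = q.under R := ⟨_, rfl⟩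
  have : p.IsPrime := hp ▸ inferInstance
  have hker := Ideal.under_eq_ker_of_liesOver (R := R) (K := K) q Q
  rw [← hp] at hker
  obtain ⟨e⟩ := Ideal.ResidueField.exists_algEquiv hK p hker
  have : Algebra.QuasiFinite R K := .of_surjective_algHom e.toAlgHom e.surjective
  have := MvPolynomial.quasiFinite_of_quasiFinite (R := R) (K := K) (σ := Fin d)
  algebraize [α.toRingHom, φ'.toRingHom, (algebraMap S F).comp α.toRingHom]
  have : IsScalarTower R A S := .of_algebraMap_eq' α.comp_algebraMap.symm
  have : IsScalarTower A B F := .of_algebraMap_eq' <| by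
    refine MvPolynomial.ringHom_ext (fun a ↦ ?_) fun i ↦ ?_
    · change algebraMap S F (α (.C a)) = φ' (MvPolynomial.map (algebraMap R K) (.C a))
      rw [MvPolynomial.map_C, MvPolynomial.algHom_C, MvPolynomial.algHom_C,
        ← IsScalarTower.algebraMap_apply, ← IsScalarTower.algebraMap_apply]
    · change algebraMap S F (α (.X i)) = φ' (MvPolynomial.map (algebraMap R K) (.X i))
      rw [MvPolynomial.map_X, MvPolynomial.aeval_X, MvPolynomial.aeval_X]
  have : Module.Finite B F := hφ'
  have : Algebra.QuasiFinite A F := .trans A B F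
  refine ⟨inferInstance, inferInstance, ?_⟩
  have : Algebra.FiniteType A S := .of_restrictScalars_finiteType R _ _
  have := Algebra.WeaklyQuasiFiniteAt.of_quasiFinite_isPushout hK q Q (A := A)
  exact .of_weaklyQuasiFiniteAt q

/-- A flat algebra of finite presentation whose differentials are free at `q` is smooth at `q` if it
is smooth at some generic point specialising to `q`. -/
theorem Algebra.IsSmoothAt.of_mem_minimalPrimes [Algebra.FinitePresentation R S]
    (hK : ∀ x : K, ∃ a s : R, algebraMap R K s ≠ 0 ∧ x * algebraMap R K s = algebraMap R K a)
    (q : Ideal S) (Q : Ideal F) [q.IsPrime] [Q.IsPrime] [Q.LiesOver q]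
    [Module.Flat R (Localization.AtPrime q)]
    [Module.Free (Localization.AtPrime q) Ω[Localization.AtPrime q⁄R]]
    (P : Ideal S) [P.IsPrime] (hP : P ∈ minimalPrimes S) (hPq : P ≤ q) [Algebra.IsSmoothAt R P] :
    Algebra.IsSmoothAt R q := by
  by_contra hq
  have hQ : ¬ Algebra.IsSmoothAt K Q := fun _ ↦ hq (.of_isSmoothAt_fiber hK q Q)
  have := KaehlerDifferential.free_atPrime_of_isPushout (R := R) (K := K) q Q
  have : Algebra.FiniteType K F :=
    .equiv inferInstance (Algebra.IsPushout.equiv R K S F)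
  obtain ⟨g, hg, hdim⟩ := Algebra.exists_ringKrullDim_away_lt_of_not_isSmoothAt (k := K) Q
    (KaehlerDifferential.finrank_atPrime_of_isPushout (R := R) (K := K) q Q) hQ
  -- Up to a unit `g` comes from some `h` in `S`, so the small neighbourhood `F'` of `Q` is the
  -- fibre of `S'`.
  obtain ⟨r, hr, h, hh⟩ := Algebra.IsPushout.exists_algebraMap_mul_eq (S := S) hK g
  have hr' : IsUnit (algebraMap R F r) := by
    rw [IsScalarTower.algebraMap_apply R K F]
    exact hr.isUnit.map _
  have hhQ : algebraMap S F h ∉ Q := by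
    rw [← hh]
    exact Q.primeCompl.mul_mem (fun h ↦ ‹Q.IsPrime›.1 (Q.eq_top_of_isUnit_mem h hr')) hg
  have hhq : h ∉ q := by rwa [Q.over_def q]
  let S' := Localization.Away h
  let F' := Localization.Away g
  have : IsLocalization.Away (algebraMap S F h) F' := by
    refine IsLocalization.Away.of_associated (r := g) ?_
    rw [← hh]
    exact (associated_unit_mul_left g _ hr').symm
  let ψ : S' →ₐ[S] F' := IsLocalization.liftAlgHom (M := .powers h) (f := Algebra.ofId S F') <| by
    rintro ⟨_, k, rfl⟩
    change IsUnit (algebraMap S F' (h ^ k))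
    rw [map_pow, IsScalarTower.algebraMap_apply S F F']
    exact (IsLocalization.Away.algebraMap_isUnit (S := F') (algebraMap S F h)).pow k
  algebraize [ψ.toRingHom]
  have : IsScalarTower S S' F' := .of_algebraMap_eq' ψ.comp_algebraMap.symm
  have : IsScalarTower R S F' := .to₁₂₄ R S F F'
  have : IsScalarTower R S' F' := .to₁₃₄ R S S' F'
  have : Algebra.IsPushout R K S' F' := by
    have : IsLocalization (Algebra.algebraMapSubmonoid F (.powers h)) F' := by
      simpa [Algebra.algebraMapSubmonoid, Submonoid.map_powers] using
        (inferInstance : IsLocalization.Away (algebraMap S F h) F')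
    have h₁ : Algebra.IsPushout S S' F F' :=
      .symm (Algebra.isPushout_of_isLocalization (.powers h) S' F F')
    have : Algebra.IsPushout R S K F := .symm ‹_›
    exact .symm ((Algebra.IsPushout.comp_iff (R := R) (S := S) (T := S') (R' := K) (S' := F)
      (T' := F')).mpr h₁)
  have hqd : Disjoint (Submonoid.powers h : Set S) q :=
    (Ideal.disjoint_powers_iff_notMem_of_isPrime h).mpr hhq
  have hPd : Disjoint (Submonoid.powers h : Set S) P :=
    (Ideal.disjoint_powers_iff_notMem_of_isPrime h).mpr fun hh ↦ hhq (hPq hh)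
  have hQd : Disjoint (Submonoid.powers g : Set F) Q :=
    (Ideal.disjoint_powers_iff_notMem_of_isPrime g).mpr hg
  let q' := q.map (algebraMap S S')
  let P' := P.map (algebraMap S S')
  let Q' := Q.map (algebraMap F F')
  have : q'.IsPrime := IsLocalization.isPrime_of_isPrime_disjoint (.powers h) S' q ‹_› hqd
  have : P'.IsPrime := IsLocalization.isPrime_of_isPrime_disjoint (.powers h) S' P ‹_› hPd
  have : Q'.IsPrime := IsLocalization.isPrime_of_isPrime_disjoint (.powers g) F' Q ‹_› hQd
  have hP'under : P'.under S = P :=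
    IsLocalization.under_map_of_isPrime_disjoint (.powers h) S' ‹_› hPd
  have : Q'.LiesOver q' := by
    refine ⟨?_⟩
    rw [← IsLocalization.map_under (.powers h) S' (Q'.under S'), Ideal.under_under,
      ← Ideal.under_under (A := S) (B := F) Q',
      IsLocalization.under_map_of_isPrime_disjoint (.powers g) F' ‹_› hQd, ← Q.over_def q]
  have hP' : P' ∈ minimalPrimes S' := by
    refine ⟨⟨‹_›, bot_le⟩, fun J hJ hJP ↦ ?_⟩
    have := hJ.1
    refine Ideal.map_le_iff_le_comap.mpr (hP.2 ⟨inferInstance, bot_le⟩ ?_)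
    rw [← hP'under]
    exact Ideal.comap_mono hJP
  let SP := Localization.AtPrime P'
  have hunit (J : Ideal S) (hPJ : P ≤ J) (x : S) (hx : x ∉ J) : IsUnit (algebraMap S SP x) := by
    rw [IsScalarTower.algebraMap_apply S S' SP]
    refine IsLocalization.map_units SP (⟨_, fun h ↦ hx (hPJ ?_)⟩ : P'.primeCompl)
    rwa [← hP'under]
  have : Algebra.FormallyEtale S S' := .of_isLocalization (.powers h)
  have : Algebra.FormallyEtale S' SP := .of_isLocalization P'.primeCompl
  have : Algebra.FormallyEtale S SP := .comp S S' SP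
  have : Algebra.IsSmoothAt R P' :=
    Algebra.IsSmoothAt.formallySmooth_of_formallyEtale P (hunit P le_rfl)
  have : Algebra.FinitePresentation S S' := IsLocalization.Away.finitePresentation h
  have : Algebra.FinitePresentation R S' := .trans R S S'
  have : Algebra.FiniteType K F' :=
    .trans ‹_› (IsLocalization.finiteType_of_monoid_fg (.powers g) F')
  have : Nontrivial F' :=
    ⟨0, 1, fun h ↦ ‹Q'.IsPrime›.1 ((Ideal.eq_top_iff_one _).mpr (h ▸ zero_mem _))⟩
  obtain ⟨d, φ, hφ, hd⟩ := exists_algHom_finite_and_le_ringKrullDim K F'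
  obtain ⟨_, _, _⟩ := Algebra.exists_quasiFiniteAt_mvPolynomial_of_finite_fiber hK q' Q' φ hφ
  -- Quasi-finiteness passes to generisations. This carries the dimension bound from the fibre
  -- through `q` to the generic point `P`, possibly in another fibre.
  have : Algebra.QuasiFiniteAt (MvPolynomial (Fin d) R) P' := .of_le (Ideal.map_mono hPq : P' ≤ q')
  have hle := Algebra.IsSmoothAt.finrank_le_of_quasiFiniteAt (R := R) (d := d) P' hP'
  rw [KaehlerDifferential.finrank_eq_finrank_atPrime (T := SP) q (hunit q hPq)] at hle
  -- The contradiction is `n ≤ d ≤ dim F' < n`.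
  exact absurd (hd.trans_lt hdim) (not_lt.mpr (by exact_mod_cast hle))

end SmoothFiber

/-! ### The equivalences for rings. -/

section Criterion

variable {R S K F : Type u} [CommRing R] [CommRing S] [CommRing F] [Algebra R S]

lemma Algebra.IsSmoothAt.flat [Algebra.FinitePresentation R S] (q : Ideal S) [q.IsPrime]
    [Algebra.IsSmoothAt R q] : Module.Flat R (Localization.AtPrime q) := by
  obtain ⟨f, hf, _⟩ := Algebra.IsSmoothAt.exists_notMem_smooth R q
  let T := Localization.Away f
  let Sq := Localization.AtPrime q
  let φ : T →ₐ[S] Sq := IsLocalization.liftAlgHom (M := .powers f) (f := Algebra.ofId S Sq) <| by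
    rintro ⟨_, k, rfl⟩
    exact IsLocalization.map_units Sq (⟨f ^ k, q.primeCompl.pow_mem hf k⟩ : q.primeCompl)
  algebraize [φ.toRingHom]
  have : IsScalarTower S T Sq := .of_algebraMap_eq' φ.comp_algebraMap.symm
  have : IsScalarTower R T Sq := .to₁₃₄ _ S _ _
  have : IsLocalization (Algebra.algebraMapSubmonoid T q.primeCompl) Sq :=
    .isLocalization_of_submonoid_le _ _ (.powers f) _ ((Submonoid.powers_le).mpr hf)
  have : Module.Flat T Sq := IsLocalization.flat Sq (Algebra.algebraMapSubmonoid T q.primeCompl)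
  have : Module.Flat R T := inferInstance
  exact .trans R T Sq

lemma Algebra.IsSmoothAt.free_kaehlerDifferential [Algebra.FinitePresentation R S] (q : Ideal S)
    [q.IsPrime] [Algebra.IsSmoothAt R q] :
    Module.Free (Localization.AtPrime q) Ω[Localization.AtPrime q⁄R] := by
  have : Algebra.EssFiniteType S (Localization.AtPrime q) := .of_isLocalization _ q.primeCompl
  have : Algebra.EssFiniteType R (Localization.AtPrime q) := .comp _ S _
  exact Module.free_of_flat_of_isLocalRing

lemma Algebra.IsSmoothAt.of_le (P q : Ideal S) [P.IsPrime] [q.IsPrime] (h : P ≤ q)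
    [Algebra.IsSmoothAt R q] : Algebra.IsSmoothAt R P := by
  have : Algebra.FormallyEtale S (Localization.AtPrime P) := .of_isLocalization P.primeCompl
  exact Algebra.IsSmoothAt.formallySmooth_of_formallyEtale q fun x hx ↦
    IsLocalization.map_units _ (⟨x, fun hP ↦ hx (h hP)⟩ : P.primeCompl)

/-- The fibral criteria for smoothness at a prime, where `K` is a field generated by `R` and
`F = K ⊗ S`. -/
theorem Algebra.IsSmoothAt.tfae_of_field [Field K] [Algebra R K] [Algebra R F] [Algebra S F]
    [Algebra K F] [IsScalarTower R S F] [IsScalarTower R K F] [Algebra.IsPushout R K S F]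
    [Algebra.FinitePresentation R S]
    (hK : ∀ x : K, ∃ a s : R, algebraMap R K s ≠ 0 ∧ x * algebraMap R K s = algebraMap R K a)
    (q : Ideal S) (Q : Ideal F) [q.IsPrime] [Q.IsPrime] [Q.LiesOver q] :
    List.TFAE [
      Algebra.IsSmoothAt R q,
      Module.Flat R (Localization.AtPrime q) ∧
        Module.Free (Localization.AtPrime q) Ω[Localization.AtPrime q⁄R] ∧
        ∀ P : PrimeSpectrum S, P.asIdeal ∈ minimalPrimes S → P.asIdeal ≤ q →
          Algebra.IsSmoothAt R P.asIdeal,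
      Module.Flat R (Localization.AtPrime q) ∧
        Module.Free (Localization.AtPrime q) Ω[Localization.AtPrime q⁄R] ∧
        (Module.finrank (Localization.AtPrime q) Ω[Localization.AtPrime q⁄R] : WithBot ℕ∞) =
          ⨅ (g : F) (_ : g ∉ Q), ringKrullDim (Localization.Away g),
      Module.Flat R (Localization.AtPrime q) ∧
        Module.Free (Localization.AtPrime q) Ω[Localization.AtPrime q⁄R] ∧
        ∀ P : PrimeSpectrum F, P.asIdeal ∈ minimalPrimes F → P.asIdeal ≤ Q →
          Algebra.IsSmoothAt K P.asIdeal] := by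
  have : Algebra.FiniteType K F := .equiv inferInstance (Algebra.IsPushout.equiv R K S F)
  have : Algebra.FinitePresentation K F := Algebra.FinitePresentation.of_finiteType.mp ‹_›
  tfae_have 1 → 2 := fun h ↦ ⟨h.flat q, h.free_kaehlerDifferential q, fun P _ hP ↦ .of_le _ q hP⟩
  tfae_have 1 → 3 := fun h ↦ by
    have hfree := h.free_kaehlerDifferential q
    refine ⟨h.flat q, hfree, ?_⟩
    have : Algebra.IsSmoothAt K Q := .of_isPushout (R := R) q Q
    have := KaehlerDifferential.free_atPrime_of_isPushout (R := R) (K := K) q Q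
    have hn := KaehlerDifferential.finrank_atPrime_of_isPushout (R := R) (K := K) q Q
    refine le_antisymm ?_ ?_
    · rw [← hn]
      exact le_iInf₂ fun g hg ↦ Algebra.IsSmoothAt.finrank_le_ringKrullDim_away Q hg
    · obtain ⟨g, hg, hle⟩ :=
        Algebra.exists_ringKrullDim_away_le_of_finrank_kaehlerDifferential (k := K) Q hn
      exact (iInf₂_le g hg).trans hle
  tfae_have 1 → 4 := fun h ↦ by
    have : Algebra.IsSmoothAt K Q := .of_isPushout (R := R) q Q
    exact ⟨h.flat q, h.free_kaehlerDifferential q, fun P _ hP ↦ .of_le _ Q hP⟩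
  tfae_have 2 → 1 := fun ⟨_, _, h⟩ ↦ by
    obtain ⟨P, hP, hPq⟩ := Ideal.exists_minimalPrimes_le (J := q) bot_le
    have : P.IsPrime := hP.1.1
    have := h ⟨P, this⟩ hP hPq
    exact .of_mem_minimalPrimes hK q Q P hP hPq
  tfae_have 3 → 1 := fun ⟨_, _, h⟩ ↦ by
    suffices Algebra.IsSmoothAt K Q from .of_isSmoothAt_fiber hK q Q
    by_contra hQ
    have := KaehlerDifferential.free_atPrime_of_isPushout (R := R) (K := K) q Q
    obtain ⟨g, hg, hlt⟩ := Algebra.exists_ringKrullDim_away_lt_of_not_isSmoothAt (k := K) Q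
      (KaehlerDifferential.finrank_atPrime_of_isPushout (R := R) (K := K) q Q) hQ
    exact (((iInf₂_le g hg).trans_lt hlt).trans_eq h).false
  tfae_have 4 → 1 := fun ⟨_, _, h⟩ ↦ by
    have := KaehlerDifferential.free_atPrime_of_isPushout (R := R) (K := K) q Q
    obtain ⟨P, hP, hPQ⟩ := Ideal.exists_minimalPrimes_le (J := Q) bot_le
    have : P.IsPrime := hP.1.1
    have := h ⟨P, this⟩ hP hPQ
    have : Q.LiesOver Q := ⟨rfl⟩
    -- The generic-point criterion is applied with base `K`, so that `F` is its own fibre and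
    -- flatness is automatic.
    have : Algebra.IsSmoothAt K Q := .of_mem_minimalPrimes (K := K) (F := F)
      (fun x ↦ ⟨x, 1, by simp, by simp⟩) Q Q P hP hPQ
    exact .of_isSmoothAt_fiber hK q Q
  tfae_finish

/-- Global sections of the spectrum of a residue field carry a given ring structure and are a field
only as a property; hence `IsField` in place of an instance. -/
theorem Algebra.IsSmoothAt.tfae [CommRing K] (hfield : IsField K)
    [Algebra R K] [Algebra R F] [Algebra S F]
    [Algebra K F] [IsScalarTower R S F] [IsScalarTower R K F] [Algebra.IsPushout R K S F]
    [Algebra.FinitePresentation R S]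
    (hK : ∀ x : K, ∃ a s : R, algebraMap R K s ≠ 0 ∧ x * algebraMap R K s = algebraMap R K a)
    (q : Ideal S) (Q : Ideal F) [q.IsPrime] [Q.IsPrime] [Q.LiesOver q] :
    List.TFAE [
      Algebra.IsSmoothAt R q,
      Module.Flat R (Localization.AtPrime q) ∧
        Module.Free (Localization.AtPrime q) Ω[Localization.AtPrime q⁄R] ∧
        ∀ P : PrimeSpectrum S, P.asIdeal ∈ minimalPrimes S → P.asIdeal ≤ q →
          Algebra.IsSmoothAt R P.asIdeal,
      Module.Flat R (Localization.AtPrime q) ∧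
        Module.Free (Localization.AtPrime q) Ω[Localization.AtPrime q⁄R] ∧
        (Module.finrank (Localization.AtPrime q) Ω[Localization.AtPrime q⁄R] : WithBot ℕ∞) =
          ⨅ (g : F) (_ : g ∉ Q), ringKrullDim (Localization.Away g),
      Module.Flat R (Localization.AtPrime q) ∧
        Module.Free (Localization.AtPrime q) Ω[Localization.AtPrime q⁄R] ∧
        ∀ P : PrimeSpectrum F, P.asIdeal ∈ minimalPrimes F → P.asIdeal ≤ Q →
          Algebra.IsSmoothAt K P.asIdeal] := by
  let _ : Field K := hfield.toField
  exact Algebra.IsSmoothAt.tfae_of_field hK q Q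

end Criterion

/-! ### Invariance of differentials under isomorphism and localisation. -/

section Differentials

lemma Algebra.FormallyEtale.of_bijective_algebraMap {R S : Type*} [CommRing R] [CommRing S]
    [Algebra R S] (h : Function.Bijective (algebraMap R S)) : Algebra.FormallyEtale R S :=
  .of_equiv (.ofBijective (Algebra.ofId R S) h)

/-- Kähler differentials do not change along a formally unramified change of base ring. -/
noncomputable def KaehlerDifferential.equivOfFormallyUnramified (R A B : Type*) [CommRing R]
    [CommRing A] [CommRing B] [Algebra R A] [Algebra A B] [Algebra R B] [IsScalarTower R A B]
    [Algebra.FormallyUnramified R A] : Ω[B⁄R] ≃ₗ[B] Ω[B⁄A] :=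
  .ofBijective (KaehlerDifferential.map R A B B)
    ⟨by
      rw [injective_iff_map_eq_zero]
      intro x hx
      obtain ⟨y, rfl⟩ := (KaehlerDifferential.exact_mapBaseChange_map R A B x).mp hx
      rw [Subsingleton.elim y 0, map_zero], KaehlerDifferential.map_surjective R A B⟩

/-- Stalk maps match maps of localisations only up to isomorphism of arrows. Isomorphisms are
formally étale on both source and target, so freeness and rank are unchanged. -/
lemma CommRingCat.free_kaehlerDifferential_of_arrowIso {A B A' B' : CommRingCat.{u}}
    {f : A ⟶ B} {g : A' ⟶ B'} (e : Arrow.mk f ≅ Arrow.mk g) [Nontrivial B']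
    (hf : Module.Free B (CommRingCat.KaehlerDifferential f)) :
    Module.Free B' (CommRingCat.KaehlerDifferential g) ∧
      Module.finrank B' (CommRingCat.KaehlerDifferential g) =
        Module.finrank B (CommRingCat.KaehlerDifferential f) := by
  let eA : A ≅ A' := Arrow.leftFunc.mapIso e
  let eB : B ≅ B' := Arrow.rightFunc.mapIso e
  have h : f ≫ eB.hom = eA.hom ≫ g := (Arrow.w e.hom).symm
  algebraize [f.hom, g.hom, eA.hom.hom, eB.hom.hom, (f ≫ eB.hom).hom]
  have : IsScalarTower A B B' := .of_algebraMap_eq' rfl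
  have : IsScalarTower A A' B' := .of_algebraMap_eq' congr(($h).hom)
  have : Algebra.FormallyEtale A A' :=
    .of_bijective_algebraMap eA.commRingCatIsoToRingEquiv.bijective
  have : Algebra.FormallyEtale B B' :=
    .of_bijective_algebraMap eB.commRingCatIsoToRingEquiv.bijective
  have : Module.Free B Ω[B⁄A] := hf
  have := KaehlerDifferential.free_of_formallyEtale (R := A) (S := B) (T := B')
  have e' := KaehlerDifferential.equivOfFormallyUnramified A A' B'
  refine ⟨(.of_equiv e' : Module.Free B' Ω[B'⁄A']), ?_⟩
  change Module.finrank B' Ω[B'⁄A'] = Module.finrank B Ω[B⁄A]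
  rw [← e'.finrank_eq, KaehlerDifferential.finrank_of_formallyEtale (S := B)]

end Differentials

/-! ### Flatness and differentials of stalks in affine charts. -/

namespace AlgebraicGeometry

section Affine

variable {X Y : Scheme.{u}} {f : X ⟶ Y} {x : X} {U : Y.Opens} {V : X.Opens}
  (hV : IsAffineOpen V) (hVU : V ≤ f ⁻¹ᵁ U) (hx : x ∈ V)

lemma flat_stalkMap_iff (hU : IsAffineOpen U) :
    letI := (f.appLE U V hVU).hom.toAlgebra
    (f.stalkMap x).hom.Flat ↔
      Module.Flat Γ(Y, U) (Localization.AtPrime (hV.primeIdealOf ⟨x, hx⟩).asIdeal) := by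
  let := (f.appLE U V hVU).hom.toAlgebra
  let p := (hU.primeIdealOf ⟨f x, hVU hx⟩).asIdeal
  let q := (hV.primeIdealOf ⟨x, hx⟩).asIdeal
  have : q.LiesOver p :=
    ⟨congr($(IsAffineOpen.comap_primeIdealOf_appLE U hU V hV hVU hx).1).symm⟩
  let := Localization.AtPrime.algebraOfLiesOver p q
  trans Module.Flat (Localization.AtPrime p) (Localization.AtPrime q)
  · rw [← RingHom.flat_algebraMap_iff]
    exact RingHom.Flat.respectsIso.arrow_mk_iso_iff
      (IsAffineOpen.arrowStalkMapIso f U hU V hV hVU hx)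
  · exact Module.flat_iff_of_isLocalization (Localization.AtPrime p) p.primeCompl _

lemma free_differentialsStalk_iff (hU : IsAffineOpen U) :
    letI := (f.appLE U V hVU).hom.toAlgebra
    Module.Free (X.presheaf.stalk x) (f.differentialsStalk x) ↔
      Module.Free (Localization.AtPrime (hV.primeIdealOf ⟨x, hx⟩).asIdeal)
        Ω[Localization.AtPrime (hV.primeIdealOf ⟨x, hx⟩).asIdeal⁄Γ(Y, U)] := by
  let := (f.appLE U V hVU).hom.toAlgebra
  let p := (hU.primeIdealOf ⟨f x, hVU hx⟩).asIdeal
  let q := (hV.primeIdealOf ⟨x, hx⟩).asIdeal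
  have : q.LiesOver p :=
    ⟨congr($(IsAffineOpen.comap_primeIdealOf_appLE U hU V hV hVU hx).1).symm⟩
  let := Localization.AtPrime.algebraOfLiesOver p q
  let e := KaehlerDifferential.equivOfFormallyUnramified Γ(Y, U) (Localization.AtPrime p)
    (Localization.AtPrime q)
  have i := IsAffineOpen.arrowStalkMapIso f U hU V hV hVU hx
  trans Module.Free (Localization.AtPrime q) Ω[Localization.AtPrime q⁄Localization.AtPrime p]
  · have : Nontrivial (CommRingCat.of (Localization.AtPrime q)) :=
      inferInstanceAs (Nontrivial (Localization.AtPrime q))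
    exact ⟨fun h ↦ (CommRingCat.free_kaehlerDifferential_of_arrowIso i h).1,
      fun h ↦ (CommRingCat.free_kaehlerDifferential_of_arrowIso i.symm h).1⟩
  · exact ⟨fun _ ↦ .of_equiv e.symm, fun _ ↦ .of_equiv e⟩

lemma differentialsRank_eq (hU : IsAffineOpen U)
    (hfree : Module.Free (X.presheaf.stalk x) (f.differentialsStalk x)) :
    letI := (f.appLE U V hVU).hom.toAlgebra
    f.differentialsRank x =
      Module.finrank (Localization.AtPrime (hV.primeIdealOf ⟨x, hx⟩).asIdeal)
        Ω[Localization.AtPrime (hV.primeIdealOf ⟨x, hx⟩).asIdeal⁄Γ(Y, U)] := by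
  let := (f.appLE U V hVU).hom.toAlgebra
  let p := (hU.primeIdealOf ⟨f x, hVU hx⟩).asIdeal
  let q := (hV.primeIdealOf ⟨x, hx⟩).asIdeal
  have : q.LiesOver p :=
    ⟨congr($(IsAffineOpen.comap_primeIdealOf_appLE U hU V hV hVU hx).1).symm⟩
  let := Localization.AtPrime.algebraOfLiesOver p q
  let e := KaehlerDifferential.equivOfFormallyUnramified Γ(Y, U) (Localization.AtPrime p)
    (Localization.AtPrime q)
  have i := IsAffineOpen.arrowStalkMapIso f U hU V hV hVU hx
  have : Nontrivial (CommRingCat.of (Localization.AtPrime q)) :=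
    inferInstanceAs (Nontrivial (Localization.AtPrime q))
  exact (CommRingCat.free_kaehlerDifferential_of_arrowIso i hfree).2.symm.trans e.finrank_eq.symm

end Affine

end AlgebraicGeometry

/-! ### Maximal points, local dimension and smoothness in affine charts. -/

namespace AlgebraicGeometry

namespace IsAffineOpen

variable {X : Scheme.{u}} {V : X.Opens} (hV : IsAffineOpen V)

lemma fromSpec_mem (P : PrimeSpectrum Γ(X, V)) : hV.fromSpec P ∈ V := by
  have : hV.fromSpec P ∈ hV.fromSpec.opensRange := ⟨P, rfl⟩
  rwa [hV.opensRange_fromSpec] at this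

lemma primeIdealOf_fromSpec (P : PrimeSpectrum Γ(X, V)) :
    hV.primeIdealOf ⟨hV.fromSpec P, hV.fromSpec_mem P⟩ = P :=
  hV.fromSpec.isOpenEmbedding.injective (hV.fromSpec_primeIdealOf _)

lemma specializes_iff_primeIdealOf_le {x y : X} (hx : x ∈ V) (hy : y ∈ V) :
    x ⤳ y ↔ hV.primeIdealOf ⟨x, hx⟩ ≤ hV.primeIdealOf ⟨y, hy⟩ := by
  have h := hV.fromSpec.isOpenEmbedding.isInducing.specializes_iff
    (x := hV.primeIdealOf ⟨x, hx⟩) (y := hV.primeIdealOf ⟨y, hy⟩)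
  have hx' := hV.fromSpec_primeIdealOf ⟨x, hx⟩
  have hy' := hV.fromSpec_primeIdealOf ⟨y, hy⟩
  rw [hx', hy'] at h
  exact h.trans (PrimeSpectrum.le_iff_specializes _ _).symm

lemma mem_maximalPoints_iff {x : X} (hx : x ∈ V) :
    x ∈ X.maximalPoints ↔ (hV.primeIdealOf ⟨x, hx⟩).asIdeal ∈ minimalPrimes Γ(X, V) := by
  constructor
  · refine fun h ↦ ⟨⟨inferInstance, bot_le⟩, fun P hP hle ↦ ?_⟩
    have := hP.1
    have hs : hV.fromSpec ⟨P, this⟩ ⤳ x := by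
      rw [hV.specializes_iff_primeIdealOf_le (hV.fromSpec_mem _) hx, hV.primeIdealOf_fromSpec]
      exact hle
    have heq := h _ hs
    have : hV.primeIdealOf ⟨x, hx⟩ = ⟨P, this⟩ := by
      rw [← hV.primeIdealOf_fromSpec ⟨P, this⟩]
      simp only [heq]
    rw [this]
  · intro h y hy
    -- Opens are stable under generisation, so maximality can be tested inside the chart.
    have hyV : y ∈ V := hy.mem_open V.2 hx
    have hle := (hV.specializes_iff_primeIdealOf_le hyV hx).mp hy
    have heq : hV.primeIdealOf ⟨y, hyV⟩ = hV.primeIdealOf ⟨x, hx⟩ :=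
      le_antisymm hle (h.2 ⟨inferInstance, bot_le⟩ hle)
    have hy' := hV.fromSpec_primeIdealOf ⟨y, hyV⟩
    rw [heq] at hy'
    exact hy'.symm.trans (hV.fromSpec_primeIdealOf ⟨x, hx⟩)

lemma mem_basicOpen_iff {x : X} (hx : x ∈ V) (g : Γ(X, V)) :
    x ∈ X.basicOpen g ↔ g ∉ (hV.primeIdealOf ⟨x, hx⟩).asIdeal := by
  have h : hV.fromSpec (hV.primeIdealOf ⟨x, hx⟩) ∈ X.basicOpen g ↔
      hV.primeIdealOf ⟨x, hx⟩ ∈ PrimeSpectrum.basicOpen g :=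
    iff_of_eq congr(hV.primeIdealOf ⟨x, hx⟩ ∈ $(hV.fromSpec_preimage_basicOpen g))
  rwa [hV.fromSpec_primeIdealOf ⟨x, hx⟩] at h

lemma topologicalKrullDim_basicOpen {X : Scheme.{u}} {V : X.Opens} (hV : IsAffineOpen V)
    (g : Γ(X, V)) :
    topologicalKrullDim (X.basicOpen g) = ringKrullDim (Localization.Away g) := by
  have := hV.isLocalization_basicOpen g
  rw [ringKrullDim_eq_of_ringEquiv
    (IsLocalization.algEquiv (.powers g) (Localization.Away g) Γ(X, X.basicOpen g)).toRingEquiv,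
    ← PrimeSpectrum.topologicalKrullDim_eq_ringKrullDim]
  exact (hV.basicOpen g).isoSpec.schemeIsoToHomeo.isHomeomorph.topologicalKrullDim_eq

/-- The local dimension of a scheme is computed by the basic opens of an affine open. -/
lemma dimensionAt_eq {x : X} (hx : x ∈ V) :
    dimensionAt x = ⨅ (g : Γ(X, V)) (_ : g ∉ (hV.primeIdealOf ⟨x, hx⟩).asIdeal),
      ringKrullDim (Localization.Away g) := by
  refine le_antisymm (le_iInf₂ fun g hg ↦ ?_) (le_iInf₂ fun O hO ↦ ?_)
  · rw [← hV.topologicalKrullDim_basicOpen]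
    exact iInf₂_le (X.basicOpen g) ((hV.mem_basicOpen_iff hx g).mpr hg)
  · obtain ⟨g, hgO, hg⟩ := hV.exists_basicOpen_le (V := O) ⟨x, hO⟩ hx
    refine (iInf₂_le g ((hV.mem_basicOpen_iff hx g).mp hg)).trans ?_
    rw [← hV.topologicalKrullDim_basicOpen]
    exact (Topology.IsEmbedding.inclusion hgO).isInducing.topologicalKrullDim_le

end IsAffineOpen

section Smooth

variable {X Y : Scheme.{u}} {f : X ⟶ Y} {x : X} {U : Y.Opens} {V : X.Opens}
  (hV : IsAffineOpen V) (hVU : V ≤ f ⁻¹ᵁ U) (hx : x ∈ V)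

lemma isSmoothAt_iff [LocallyOfFinitePresentation f] (hU : IsAffineOpen U) :
    letI := (f.appLE U V hVU).hom.toAlgebra
    f.IsSmoothAt x ↔ Algebra.IsSmoothAt Γ(Y, U) (hV.primeIdealOf ⟨x, hx⟩).asIdeal := by
  rw [Scheme.Hom.IsSmoothAt, and_iff_right ‹_›]
  exact formallySmooth_stalkMap_iff U hU V hV hVU hx

lemma forall_maximalPoints_isSmoothAt_iff [LocallyOfFinitePresentation f] (hU : IsAffineOpen U) :
    letI := (f.appLE U V hVU).hom.toAlgebra
    (∀ ξ ∈ X.maximalPoints, ξ ⤳ x → f.IsSmoothAt ξ) ↔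
      ∀ P : PrimeSpectrum Γ(X, V), P.asIdeal ∈ minimalPrimes Γ(X, V) →
        P.asIdeal ≤ (hV.primeIdealOf ⟨x, hx⟩).asIdeal → Algebra.IsSmoothAt Γ(Y, U) P.asIdeal := by
  constructor
  · intro h P hP hle
    have hmem := hV.fromSpec_mem P
    have := h (hV.fromSpec P)
    rw [hV.mem_maximalPoints_iff hmem, hV.specializes_iff_primeIdealOf_le hmem hx,
      isSmoothAt_iff hV hVU hmem hU, hV.primeIdealOf_fromSpec] at this
    exact this hP hle
  · intro h ξ hξ hs
    have hmem : ξ ∈ V := hs.mem_open V.2 hx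
    rw [hV.mem_maximalPoints_iff hmem] at hξ
    rw [hV.specializes_iff_primeIdealOf_le hmem hx] at hs
    exact (isSmoothAt_iff hV hVU hmem hU).mpr (h _ hξ hs)

end Smooth

/-! ### Sections of the residue field as fractions. -/

section ResidueField

lemma ΓSpecIso_inv_map_appLE {A B : CommRingCat.{u}} (φ : A ⟶ B) {V : (Spec A).Opens}
    (e : ⊤ ≤ Spec.map φ ⁻¹ᵁ V) :
    (Scheme.ΓSpecIso A).inv ≫ (Spec A).presheaf.map (homOfLE le_top).op ≫
      (Spec.map φ).appLE V ⊤ e = φ ≫ (Scheme.ΓSpecIso B).inv := by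
  rw [Scheme.Hom.map_appLE, Scheme.ΓSpecIso_inv_naturality, Scheme.Hom.appTop,
    Scheme.Hom.app_eq_appLE]
  rfl

variable {Y : Scheme.{u}} (y : Y)

lemma isField_sections_residueField : IsField Γ(Spec (Y.residueField y), ⊤) :=
  (Scheme.ΓSpecIso (Y.residueField y)).commRingCatIsoToRingEquiv.toMulEquiv.isField
    (Field.toIsField _)

lemma le_preimage_fromSpecResidueField {U : Y.Opens} (hy : y ∈ U) :
    (⊤ : (Spec (Y.residueField y)).Opens) ≤ Y.fromSpecResidueField y ⁻¹ᵁ U := fun s _ ↦ by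
  rwa [Scheme.Hom.mem_preimage, Scheme.fromSpecResidueField_apply]

/-- The residue field at a point of an affine open is generated by the sections. -/
lemma exists_mul_appLE_fromSpecResidueField {U : Y.Opens} (hU : IsAffineOpen U) (hy : y ∈ U)
    (c : Γ(Spec (Y.residueField y), ⊤)) :
    ∃ a s : Γ(Y, U),
      (Y.fromSpecResidueField y).appLE U ⊤ (le_preimage_fromSpecResidueField y hy) s ≠ 0 ∧
      c * (Y.fromSpecResidueField y).appLE U ⊤ (le_preimage_fromSpecResidueField y hy) s =
        (Y.fromSpecResidueField y).appLE U ⊤ (le_preimage_fromSpecResidueField y hy) a := by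
  have key : (Y.fromSpecResidueField y).appLE U ⊤ (le_preimage_fromSpecResidueField y hy) =
      Y.presheaf.germ U y hy ≫ Y.residue y ≫ (Scheme.ΓSpecIso (Y.residueField y)).inv := by
    have (e : ⊤ ≤ (Spec.map (Y.residue y) ≫ Y.fromSpecStalk y) ⁻¹ᵁ U) :
        (Spec.map (Y.residue y) ≫ Y.fromSpecStalk y).appLE U ⊤ e =
          Y.presheaf.germ U y hy ≫ Y.residue y ≫
            (Scheme.ΓSpecIso (Y.residueField y)).inv := by
      rw [Scheme.Hom.comp_appLE, Scheme.fromSpecStalk_app hy, Category.assoc, Category.assoc]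
      exact congr(Y.presheaf.germ U y hy ≫ $(ΓSpecIso_inv_map_appLE (Y.residue y)
        (V := Y.fromSpecStalk y ⁻¹ᵁ U) e))
    exact this _
  let := Y.presheaf.algebra_section_stalk ⟨y, hy⟩
  have := hU.isLocalization_stalk ⟨y, hy⟩
  have hgerm : algebraMap Γ(Y, U) (Y.presheaf.stalk y) = (Y.presheaf.germ U y hy).hom := rfl
  -- Lift to the stalk and write the lift as a fraction of sections; its denominator is a unit in
  -- the stalk, so nonzero in the residue field.
  obtain ⟨d, hd⟩ := Y.residue_surjective y ((Scheme.ΓSpecIso (Y.residueField y)).hom c)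
  obtain ⟨⟨a, s⟩, has⟩ := IsLocalization.surj (hU.primeIdealOf ⟨y, hy⟩).asIdeal.primeCompl d
  have hunit := IsLocalization.map_units (Y.presheaf.stalk y) s
  have hc : c = (Scheme.ΓSpecIso (Y.residueField y)).inv (Y.residue y d) := by
    rw [hd]; simp
  rw [hgerm] at has hunit
  refine ⟨a, s, ?_, ?_⟩
  · rw [key]
    have := (hunit.map (Y.residue y).hom).map (Scheme.ΓSpecIso (Y.residueField y)).inv.hom
    exact this.ne_zero
  · rw [key, hc]
    have := congr((Scheme.ΓSpecIso (Y.residueField y)).inv (Y.residue y $has))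
    rw [map_mul, map_mul] at this
    exact this

end ResidueField

end AlgebraicGeometry

/-! ### Affine charts of the fibre and the theorem. -/

namespace AlgebraicGeometry

open Limits

variable {X Y : Scheme.{u}} (π : X ⟶ Y) {y : Y} {U : Y.Opens} {V : X.Opens}

lemma isAffineOpen_preimage_fiberι (hU : IsAffineOpen U) (hV : IsAffineOpen V)
    (hVU : V ≤ π ⁻¹ᵁ U) (hy : y ∈ U) : IsAffineOpen (π.fiberι y ⁻¹ᵁ V) := by
  have H : IsPullback (π.fiberι y) (π.fiberToSpecResidueField y) π (Y.fromSpecResidueField y) :=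
    .of_hasPullback _ _
  have : IsAffine U := hU
  have : IsAffine V := hV
  have : IsAffine (⊤ : (Spec (Y.residueField y)).Opens) := isAffineOpen_top _
  exact .of_isIso (Scheme.Hom.isPullback_resLE H (le_preimage_fromSpecResidueField y hy) hVU
    (by simp)).isoPullback.hom

lemma isPushout_appLE_fiber (hU : IsAffineOpen U) (hV : IsAffineOpen V)
    (hVU : V ≤ π ⁻¹ᵁ U) (hy : y ∈ U) :
    IsPushout (π.appLE U V hVU)
      ((Y.fromSpecResidueField y).appLE U ⊤ (le_preimage_fromSpecResidueField y hy))
      ((π.fiberι y).appLE V (π.fiberι y ⁻¹ᵁ V) le_rfl)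
      ((π.fiberToSpecResidueField y).appLE ⊤ (π.fiberι y ⁻¹ᵁ V) le_top) := by
  have H : IsPullback (π.fiberι y) (π.fiberToSpecResidueField y) π (Y.fromSpecResidueField y) :=
    .of_hasPullback _ _
  exact (isIso_pushoutSection_iff H (le_preimage_fromSpecResidueField y hy) hVU (by simp)).mp
    (isIso_pushoutSection_of_isAffineOpen H _ _ _ hU (isAffineOpen_top _) hV)

instance [LocallyOfFinitePresentation π] :
    LocallyOfFinitePresentation (π.fiberToSpecResidueField y) :=
  inferInstanceAs (LocallyOfFinitePresentation (pullback.snd π (Y.fromSpecResidueField y)))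

/-- The equivalent descriptions of smoothness at a point `w` of a fiber. -/
lemma tfae_isSmoothAt_fiberι [LocallyOfFinitePresentation π] (w : π.fiber y) :
    List.TFAE [
      π.IsSmoothAt (π.fiberι y w),
      π.IsFlatAt (π.fiberι y w) ∧ π.fiberι y w ∉ π.branchLocus ∧
        ∀ ξ ∈ X.maximalPoints, ξ ⤳ π.fiberι y w → π.IsSmoothAt ξ,
      π.IsFlatAt (π.fiberι y w) ∧ π.fiberι y w ∉ π.branchLocus ∧
        (π.differentialsRank (π.fiberι y w) : WithBot ℕ∞) = dimensionAt w,
      π.IsFlatAt (π.fiberι y w) ∧ π.fiberι y w ∉ π.branchLocus ∧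
        ∀ η ∈ (π.fiber y).maximalPoints, η ⤳ w →
          (π.fiberToSpecResidueField y).IsSmoothAt η] := by
  have hπ : π (π.fiberι y w) = y := by
    have : π.fiberι y w ∈ Set.range (π.fiberι y) := ⟨w, rfl⟩
    rwa [π.range_fiberι] at this
  obtain ⟨_, ⟨U, hU, rfl⟩, hy, -⟩ :=
    Y.isBasis_affineOpens.exists_subset_of_mem_open (Set.mem_univ y) isOpen_univ
  obtain ⟨_, ⟨V, hV, rfl⟩, hx, hVU⟩ := X.isBasis_affineOpens.exists_subset_of_mem_open
    (show π.fiberι y w ∈ π ⁻¹ᵁ U from show π (π.fiberι y w) ∈ U by rwa [hπ]) (π ⁻¹ᵁ U).2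
  let UY := π.fiberι y ⁻¹ᵁ V
  have hUY : IsAffineOpen UY := isAffineOpen_preimage_fiberι π hU hV hVU hy
  have hw : w ∈ UY := hx
  let := (π.appLE U V hVU).hom.toAlgebra
  let := ((Y.fromSpecResidueField y).appLE U ⊤
    (le_preimage_fromSpecResidueField y hy)).hom.toAlgebra
  let := ((π.fiberι y).appLE V UY le_rfl).hom.toAlgebra
  let := ((π.fiberToSpecResidueField y).appLE ⊤ UY le_top).hom.toAlgebra
  let := (π.appLE U V hVU ≫ (π.fiberι y).appLE V UY le_rfl).hom.toAlgebra
  have hp := isPushout_appLE_fiber π hU hV hVU hy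
  have : IsScalarTower Γ(Y, U) Γ(X, V) Γ(π.fiber y, UY) := .of_algebraMap_eq' rfl
  have : IsScalarTower Γ(Y, U) Γ(Spec (Y.residueField y), ⊤) Γ(π.fiber y, UY) :=
    .of_algebraMap_eq' congr(($hp.w).hom)
  have : Algebra.IsPushout Γ(Y, U) Γ(Spec (Y.residueField y), ⊤) Γ(X, V) Γ(π.fiber y, UY) :=
    CommRingCat.isPushout_iff_isPushout.mp hp.flip
  have : Algebra.FinitePresentation Γ(Y, U) Γ(X, V) := π.finitePresentation_appLE hU hV hVU
  have : (hUY.primeIdealOf ⟨w, hw⟩).asIdeal.LiesOver (hV.primeIdealOf ⟨π.fiberι y w, hx⟩).asIdeal :=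
    ⟨congr($(IsAffineOpen.comap_primeIdealOf_appLE V hV UY hUY le_rfl hw).1).symm⟩
  have key := Algebra.IsSmoothAt.tfae (isField_sections_residueField y)
    (exists_mul_appLE_fromSpecResidueField y hU hy) (hV.primeIdealOf ⟨π.fiberι y w, hx⟩).asIdeal
    (hUY.primeIdealOf ⟨w, hw⟩).asIdeal
  have hflat := flat_stalkMap_iff hV hVU hx hU
  have hfree := free_differentialsStalk_iff hV hVU hx hU
  rw [← isSmoothAt_iff hV hVU hx hU, ← hflat, ← hfree,
    ← forall_maximalPoints_isSmoothAt_iff hV hVU hx hU, ← hUY.dimensionAt_eq hw,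
    ← forall_maximalPoints_isSmoothAt_iff (f := π.fiberToSpecResidueField y) hUY le_top hw
      (isAffineOpen_top _)] at key
  have hbr : π.fiberι y w ∉ π.branchLocus ↔ Module.Free (X.presheaf.stalk (π.fiberι y w))
      (π.differentialsStalk (π.fiberι y w)) := not_not
  have hrank : (π.IsFlatAt (π.fiberι y w) ∧ π.fiberι y w ∉ π.branchLocus ∧
      (π.differentialsRank (π.fiberι y w) : WithBot ℕ∞) = dimensionAt w) ↔ _ :=
    and_congr_right fun _ ↦ (and_congr_left' hbr).trans <| and_congr_right fun h ↦ by
      rw [differentialsRank_eq hV hVU hx hU h]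
  rw [hrank, hbr]
  exact key

end AlgebraicGeometry

theorem theorem3p1 {X Y : Scheme.{u}} (π : X ⟶ Y) [LocallyOfFinitePresentation π] (x : X) :
    List.TFAE [
      π.IsSmoothAt x,
      π.IsFlatAt x ∧ x ∉ π.branchLocus ∧
        ∀ ξ ∈ X.maximalPoints, ξ ⤳ x → π.IsSmoothAt ξ,
      π.IsFlatAt x ∧ x ∉ π.branchLocus ∧
        (π.differentialsRank x : WithBot ℕ∞) = dimensionAt (π.asFiber x),
      π.IsFlatAt x ∧ x ∉ π.branchLocus ∧
        ∀ η ∈ (π.fiber (π x)).maximalPoints, η ⤳ π.asFiber x →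
          (π.fiberToSpecResidueField (π x)).IsSmoothAt η] := by
  -- The local result concerns a point `w` of the fibre over an arbitrary `y`, so no dependent
  -- rewriting along `π (π.fiberι y w) = y` is needed; only here is `y` set to `π x`.
  simpa only [Scheme.Hom.fiberι_asFiber] using AlgebraicGeometry.tfae_isSmoothAt_fiberι π (π.asFiber x)
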